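/- Let $\mathcal A$ be a compact, convex and irreducible set of real $2\times 2$ matrices (irreducible: the matrices of $\mathcal A$ have no common invariant subspace other than $\{0\}$ and $\mathbb R^2$). A switching law is a measurable function $A:[0,\infty)\to\mathcal A$; a trajectory with switching law $A$ is a (Carathéodory) solution $x:[0,\infty)\to\mathbb R^2$ of $\dot x(t)=A(t)x(t)$. The Lyapunov exponent $\sigma=\sigma(\mathcal A)$ is the infimum of the numbers $s$ such that every trajectory satisfies $\|x(t)\|\le C e^{st}$, $t\ge 0$, with some constant $C=C(x)$. A norm $f$ on $\mathbb R^2$ is a Barabanov norm of $\mathcal A$ if $f(x(t))\le e^{\sigma t}f(x(0))$, $t\ge0$, for every trajectory $x$, and if from every point of $\mathbb R^2$ there starts a trajectory that is extremal for $f$, i.e. one with $f(x(t))=e^{\sigma t}f(x(0))$ for all $t\ge 0$. Then the following holds. (0) $\mathcal A$ has a Barabanov norm. (1) If $\sigma(\mathcal A)=0$, then there is a trajectory $x$ with $x(0)\neq 0$ such that, for some $T>0$, both $x$ and its switching law $A$ are $T$-periodic on $[0,\infty)$, and $x$ is extremal for every Barabanov norm of $\mathcal A$. (2) Consequently, for arbitrary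 $\sigma=\sigma(\mathcal A)$, the fastest asymptotic growth is achieved by a periodic switching law: there are $T>0$, a $T$-periodic switching law $A$ and a trajectory $x$ with this switching law and $x(0)\ne 0$ such that $e^{-\sigma t}x(t)$ is $T$-periodic, $x$ is extremal for every Barabanov norm of $\mathcal A$, and for every trajectory $y$ of the system there is a constant $C$ with $\|y(t)\|\le C\|x(t)\|$ for all $t\ge 0$. -/

import Mathlib

open Set MeasureTheory
open scoped Matrix

namespace SwitchingSystem

/-- A switching law of the control set `𝒜`: a measurable function `A : [0, ∞) → 𝒜`.
Only the values at times `t ≥ 0` matter. -/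
structure IsSwitchingLaw {d : ℕ} (𝒜 : Set (Matrix (Fin d) (Fin d) ℝ))
    (A : ℝ → Matrix (Fin d) (Fin d) ℝ) : Prop where
  mem : ∀ t, 0 ≤ t → A t ∈ 𝒜
  measurable : ∀ i j, Measurable fun t : Set.Ici (0 : ℝ) => A t i j

/-- `x : [0, ∞) → ℝ^d` is the trajectory of the system `𝒜` for the switching law `A`: it solves
`x'(t) = A(t) x(t)` in the sense of Carathéodory, written as an integral equation.
Only the values at times `t ≥ 0` matter. -/
structure IsTrajectory {d : ℕ} (𝒜 : Set (Matrix (Fin d) (Fin d) ℝ))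
    (A : ℝ → Matrix (Fin d) (Fin d) ℝ) (x : ℝ → Fin d → ℝ) : Prop where
  law : IsSwitchingLaw 𝒜 A
  integrable : ∀ t, 0 ≤ t → IntervalIntegrable (fun s => A s *ᵥ x s) volume 0 t
  eq : ∀ t, 0 ≤ t → x t = x 0 + ∫ s in (0 : ℝ)..t, A s *ᵥ x s

/-- The Lyapunov exponent `σ(𝒜)`: the infimum of the numbers `s` such that every trajectory
satisfies `‖x(t)‖ ≤ C e^{s t}`, `t ≥ 0`, with a constant `C` depending on the trajectory.
The choice of the norm on `ℝ^d` is immaterial, as all norms are equivalent. -/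
noncomputable def lyapunovExponent {d : ℕ} (𝒜 : Set (Matrix (Fin d) (Fin d) ℝ)) : ℝ :=
  sInf {s : ℝ | ∀ A x, IsTrajectory 𝒜 A x →
    ∃ C : ℝ, ∀ t, 0 ≤ t → ‖x t‖ ≤ C * Real.exp (s * t)}

/-- The matrices of `𝒜` share no invariant subspace apart from `{0}` and the whole space. -/
def Irreducible {d : ℕ} (𝒜 : Set (Matrix (Fin d) (Fin d) ℝ)) : Prop :=
  ∀ W : Submodule ℝ (Fin d → ℝ), (∀ A ∈ 𝒜, ∀ v ∈ W, A *ᵥ v ∈ W) → W = ⊥ ∨ W = ⊤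

/-- `x` is a trajectory, with the switching law `A`, of the system with control set `co(𝒜)`, and
`f(x(t)) = e^{σ(𝒜) t} f(x(0))` for all `t ≥ 0`. -/
def IsExtremal {d : ℕ} (𝒜 : Set (Matrix (Fin d) (Fin d) ℝ)) (f : Seminorm ℝ (Fin d → ℝ))
    (A : ℝ → Matrix (Fin d) (Fin d) ℝ) (x : ℝ → Fin d → ℝ) : Prop :=
  IsTrajectory (convexHull ℝ 𝒜) A x ∧
    ∀ t, 0 ≤ t → f (x t) = Real.exp (lyapunovExponent 𝒜 * t) * f (x 0)

/-- `f` is a Barabanov (invariant) norm of the system `𝒜`. -/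
structure IsBarabanovNorm {d : ℕ} (𝒜 : Set (Matrix (Fin d) (Fin d) ℝ))
    (f : Seminorm ℝ (Fin d → ℝ)) : Prop where
  definite : ∀ v, f v = 0 → v = 0
  le : ∀ A x, IsTrajectory 𝒜 A x →
    ∀ t, 0 ≤ t → f (x t) ≤ Real.exp (lyapunovExponent 𝒜 * t) * f (x 0)
  exists_extremal : ∀ v : Fin d → ℝ, ∃ A x, x 0 = v ∧ IsExtremal 𝒜 f A x

/-- `g` restricted to `[0, ∞)` is periodic with period `T > 0`. -/
def IsPeriodic {E : Type*} (g : ℝ → E) (T : ℝ) : Prop :=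
  0 < T ∧ ∀ t, 0 ≤ t → g (t + T) = g t

end SwitchingSystem

/-! Two facts carry the theorem. The first is the existence of an invariant norm `f`, valid in any
finite dimension (`exists_invariant_seminorm`). By irreducibility, the points whose solutions stay
bounded after rescaling by `e^{-σt}` form either `⊥` or `⊤`. The first is impossible: growth by a
factor `2` would occur from every point in uniformly bounded time, and iterating it gives a solution
growing faster than `σ` allows. So the limsup of `e^{-σt}‖x(t)‖` over all solutions from a point is
finite. It is a seminorm, and by irreducibility again a norm. Compactness of the set of solutions
(`exists_isSolution_tendsto`), which uses convexity, gives extremal solutions from every point.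

The second is planar topology (`returns_or_tendsto`). A rescaled extremal solution moves on a level
curve of `f`. If it never meets `±` an earlier point, it stays on one side of the line through its
start, its angle is monotone, and it converges. A return up to sign lets the law be repeated
periodically. In the convergent case the shifted solutions converge to one of the form `e^{σt} l`,
whose law on `[0, 1)` can be repeated.

Finally, a solution that is periodic after rescaling is extremal for every invariant norm, since a
loss could never be regained by the next return (`IsBarabanovNorm.eq_of_periodic`). Equivalence of
norms then gives the comparison with all trajectories. -/

open Filter Topology

/-! ### Carathéodory solutions: Grönwall bounds, uniqueness, concatenation, existence. -/

namespace SwitchingSystem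

variable {E : Type*} [NormedAddCommGroup E] [NormedSpace ℝ E]

/-- `x` solves `x' = A x` on `[0, ∞)` for a strongly measurable law `A` with values in a set `𝒞` of
operators. The law and the solution are extended to the whole line in an arbitrary way. -/
structure IsSolution (𝒞 : Set (E →L[ℝ] E)) (A : ℝ → E →L[ℝ] E) (x : ℝ → E) : Prop where
  mem : ∀ t, A t ∈ 𝒞
  meas : StronglyMeasurable A
  cont : Continuous x
  eq : ∀ t, 0 ≤ t → x t = x 0 + ∫ s in (0 : ℝ)..t, A s (x s)

/-- Grönwall in integral form: unlike `g`, the right-hand side of the hypothesis is differentiable,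
so the differential inequality is applied to it. -/
theorem le_mul_exp_of_le_add_integral {g : ℝ → ℝ} (hg : Continuous g) {a L T : ℝ} (hL : 0 ≤ L)
    (h : ∀ t ∈ Icc 0 T, g t ≤ a + L * ∫ s in (0 : ℝ)..t, g s) :
    ∀ t ∈ Icc 0 T, g t ≤ a * Real.exp (L * t) := by
  intro t ht
  have hd : ∀ t, HasDerivAt (fun t => a + L * ∫ s in (0 : ℝ)..t, g s) (L * g t) t := fun t =>
    ((hg.integral_hasStrictDerivAt 0 t).hasDerivAt.const_mul L).const_add a
  have := le_gronwallBound_of_liminf_deriv_right_le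
    (f := fun t => a + L * ∫ s in (0 : ℝ)..t, g s) (f' := fun t => L * g t)
    (δ := a) (K := L) (ε := 0) (a := 0) (b := T)
    (fun t _ => (hd t).continuousAt.continuousWithinAt)
    (fun t _ r hr => (hd t).hasDerivWithinAt.liminf_right_slope_le hr) (by simp)
    (fun t ht => by
      have := mul_le_mul_of_nonneg_left (h t ⟨ht.1, ht.2.le⟩) hL
      simpa using this) t ht
  rw [gronwallBound_ε0, sub_zero] at this
  exact (h t ht).trans this

theorem stronglyMeasurable_apply {A : ℝ → E →L[ℝ] E} (hA : StronglyMeasurable A) {x : ℝ → E}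
    (hx : Continuous x) : StronglyMeasurable fun s => A s (x s) := by
  borelize E
  have h := (hA.prodMk hx.stronglyMeasurable)
  exact (isBoundedBilinearMap_apply (𝕜 := ℝ) (E := E) (F := E)).continuous.comp_stronglyMeasurable h

theorem intervalIntegrable_apply {A : ℝ → E →L[ℝ] E} (hA : StronglyMeasurable A) {L : ℝ}
    (hL : ∀ t, ‖A t‖ ≤ L) {x : ℝ → E} (hx : Continuous x) (a b : ℝ) :
    IntervalIntegrable (fun s => A s (x s)) volume a b := by
  refine ((hx.norm.const_mul L).intervalIntegrable a b).mono_fun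
    (stronglyMeasurable_apply hA hx).aestronglyMeasurable (ae_of_all _ fun s => ?_)
  refine ((A s).le_of_opNorm_le (hL s) _).trans (le_abs_self _)

variable {𝒞 : Set (E →L[ℝ] E)} {A : ℝ → E →L[ℝ] E} {x : ℝ → E} {L : ℝ}

namespace IsSolution

theorem intervalIntegrable (h : IsSolution 𝒞 A x) (hL : ∀ B ∈ 𝒞, ‖B‖ ≤ L) (a b : ℝ) :
    IntervalIntegrable (fun s => A s (x s)) volume a b :=
  intervalIntegrable_apply h.meas (fun t => hL _ (h.mem t)) h.cont a b

theorem sub_eq (h : IsSolution 𝒞 A x) (hL : ∀ B ∈ 𝒞, ‖B‖ ≤ L) {s t : ℝ} (hs : 0 ≤ s)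
    (ht : 0 ≤ t) : x t - x s = ∫ r in s..t, A r (x r) := by
  rw [h.eq t ht, h.eq s hs, add_sub_add_left_eq_sub]
  exact intervalIntegral.integral_interval_sub_left (h.intervalIntegrable hL _ _)
    (h.intervalIntegrable hL _ _)

theorem shift (h : IsSolution 𝒞 A x) (hL : ∀ B ∈ 𝒞, ‖B‖ ≤ L) {τ : ℝ} (hτ : 0 ≤ τ) :
    IsSolution 𝒞 (fun t => A (t + τ)) (fun t => x (t + τ)) where
  mem t := h.mem _
  meas := h.meas.comp_measurable (measurable_id.add_const τ)
  cont := h.cont.comp (continuous_id.add continuous_const)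
  eq t ht := by
    rw [intervalIntegral.integral_comp_add_right (fun s => A s (x s)) τ, ← sub_eq_iff_eq_add',
      h.sub_eq hL (by simpa) (by positivity)]

theorem add {y : ℝ → E} (hx : IsSolution 𝒞 A x) (hy : IsSolution 𝒞 A y)
    (hL : ∀ B ∈ 𝒞, ‖B‖ ≤ L) : IsSolution 𝒞 A (fun t => x t + y t) where
  mem := hx.mem
  meas := hx.meas
  cont := hx.cont.add hy.cont
  eq t ht := by
    simp only [map_add]
    rw [intervalIntegral.integral_add (hx.intervalIntegrable hL _ _) (hy.intervalIntegrable hL _ _),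
      hx.eq t ht, hy.eq t ht]
    abel

theorem const_smul (hx : IsSolution 𝒞 A x) (c : ℝ) : IsSolution 𝒞 A (fun t => c • x t) where
  mem := hx.mem
  meas := hx.meas
  cont := hx.cont.const_smul c
  eq t ht := by
    simp only [map_smul]
    rw [intervalIntegral.integral_smul, hx.eq t ht, smul_add]

theorem sub {y : ℝ → E} (hx : IsSolution 𝒞 A x) (hy : IsSolution 𝒞 A y)
    (hL : ∀ B ∈ 𝒞, ‖B‖ ≤ L) : IsSolution 𝒞 A (fun t => x t - y t) := by
  simpa [sub_eq_add_neg] using hx.add (hy.const_smul (-1)) hL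

theorem norm_le (h : IsSolution 𝒞 A x) (hL : ∀ B ∈ 𝒞, ‖B‖ ≤ L) {t : ℝ} (ht : 0 ≤ t) :
    ‖x t‖ ≤ ‖x 0‖ * Real.exp (L * t) := by
  have hL0 : 0 ≤ L := (norm_nonneg _).trans (hL _ (h.mem 0))
  refine le_mul_exp_of_le_add_integral h.cont.norm hL0 (T := t) (fun s hs => ?_) t ⟨ht, le_rfl⟩
  rw [h.eq s hs.1]
  refine (norm_add_le _ _).trans (add_le_add le_rfl ?_)
  rw [← intervalIntegral.integral_const_mul]
  exact intervalIntegral.norm_integral_le_of_norm_le hs.1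
    (ae_of_all _ fun r _ => (A r).le_of_opNorm_le (hL _ (h.mem r)) _)
    ((h.cont.norm.const_mul L).intervalIntegrable _ _)

/-- Grönwall for the reversed function `s ↦ x (t - s)`. It shows that solutions decay at most like
`e^{-Lt}`, which bounds the growth rates from below. -/
theorem norm_zero_le (h : IsSolution 𝒞 A x) (hL : ∀ B ∈ 𝒞, ‖B‖ ≤ L) {t : ℝ} (ht : 0 ≤ t) :
    ‖x 0‖ ≤ ‖x t‖ * Real.exp (L * t) := by
  have hL0 : 0 ≤ L := (norm_nonneg _).trans (hL _ (h.mem 0))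
  have := le_mul_exp_of_le_add_integral (g := fun s => ‖x (t - s)‖) (a := ‖x t‖)
    (h.cont.comp (continuous_const.sub continuous_id)).norm hL0 (T := t) (fun s hs => ?_) t
    ⟨ht, le_rfl⟩
  · simpa using this
  have h1 : x (t - s) = x t - ∫ r in (t - s)..t, A r (x r) := by
    rw [← h.sub_eq hL (by linarith [hs.2]) ht]; abel
  have h2 : ∫ r in (0 : ℝ)..s, ‖x (t - r)‖ = ∫ r in (t - s)..t, ‖x r‖ := by
    simpa using intervalIntegral.integral_comp_sub_left (fun r => ‖x r‖) t (a := 0) (b := s)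
  rw [h1, h2, ← intervalIntegral.integral_const_mul]
  refine (norm_sub_le _ _).trans (add_le_add le_rfl ?_)
  exact intervalIntegral.norm_integral_le_of_norm_le (by linarith [hs.1])
    (ae_of_all _ fun r _ => (A r).le_of_opNorm_le (hL _ (h.mem r)) _)
    ((h.cont.norm.const_mul L).intervalIntegrable _ _)

/-- Uniqueness, for laws which agree on an interval. -/
theorem eq_of_eqOn {B : ℝ → E →L[ℝ] E} {y : ℝ → E} (hx : IsSolution 𝒞 A x)
    (hy : IsSolution 𝒞 B y) (hL : ∀ B ∈ 𝒞, ‖B‖ ≤ L) {T : ℝ} (hAB : ∀ t ∈ Ico 0 T, A t = B t)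
    (h0 : x 0 = y 0) {t : ℝ} (ht : t ∈ Icc 0 T) : x t = y t := by
  have hL0 : 0 ≤ L := (norm_nonneg _).trans (hL _ (hx.mem 0))
  have := le_mul_exp_of_le_add_integral (g := fun s => ‖x s - y s‖) (a := 0)
    (hx.cont.sub hy.cont).norm hL0 (T := T) (fun s hs => ?_) t ht
  · rw [zero_mul] at this
    exact sub_eq_zero.1 (norm_le_zero_iff.1 this)
  have h1 : x s - y s = ∫ r in (0 : ℝ)..s, A r (x r - y r) := by
    rw [hx.eq s hs.1, hy.eq s hs.1, h0, add_sub_add_left_eq_sub]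
    simp only [map_sub]
    rw [intervalIntegral.integral_sub (hx.intervalIntegrable hL _ _)
      (intervalIntegrable_apply hx.meas (fun t => hL _ (hx.mem t)) hy.cont _ _)]
    congr 1
    refine intervalIntegral.integral_congr_ae ?_
    -- The laws agree only on a half-open interval, which is what a periodic extension provides; the
    -- endpoint is a null set.
    filter_upwards [Measure.ae_ne volume s] with r hr hrs
    rw [uIoc_of_le hs.1] at hrs
    rw [hAB r ⟨hrs.1.le, (lt_of_le_of_ne hrs.2 hr).trans_le hs.2⟩]
  rw [h1, zero_add, ← intervalIntegral.integral_const_mul]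
  exact intervalIntegral.norm_integral_le_of_norm_le hs.1
    (ae_of_all _ fun r _ => (A r).le_of_opNorm_le (hL _ (hx.mem r)) _)
    (((hx.cont.sub hy.cont).norm.const_mul L).intervalIntegrable _ _)

theorem concat {B : ℝ → E →L[ℝ] E} {y : ℝ → E} (hx : IsSolution 𝒞 A x)
    (hy : IsSolution 𝒞 B y) (hL : ∀ B ∈ 𝒞, ‖B‖ ≤ L) {τ : ℝ} (hτ : 0 ≤ τ) (h0 : y 0 = x τ) :
    IsSolution 𝒞 (fun t => if t ≤ τ then A t else B (t - τ))
      (fun t => if t ≤ τ then x t else y (t - τ)) where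
  mem t := by
    split_ifs
    exacts [hx.mem _, hy.mem _]
  meas := StronglyMeasurable.ite measurableSet_Iic hx.meas
    (hy.meas.comp_measurable (measurable_id.sub_const τ))
  cont := by
    refine hx.cont.if_le (hy.cont.comp (continuous_id.sub continuous_const)) continuous_id
      continuous_const fun t ht => ?_
    simp [ht, h0]
  eq t ht := by
    have key : ∀ t, 0 ≤ t → t ≤ τ → (∫ s in (0 : ℝ)..t, (if s ≤ τ then A s else B (s - τ))
        (if s ≤ τ then x s else y (s - τ))) = ∫ s in (0 : ℝ)..t, A s (x s) := by
      intro t ht htτ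
      refine intervalIntegral.integral_congr fun s hs => ?_
      rw [uIcc_of_le ht] at hs
      simp [hs.2.trans htτ]
    by_cases htτ : t ≤ τ
    · rw [key t ht htτ]
      simpa [htτ, hτ] using hx.eq t ht
    · have key2 : (∫ s in τ..t, (if s ≤ τ then A s else B (s - τ))
          (if s ≤ τ then x s else y (s - τ))) = ∫ s in τ..t, B (s - τ) (y (s - τ)) := by
        refine intervalIntegral.integral_congr_ae (ae_of_all _ fun s hs => ?_)
        rw [uIoc_of_le (not_le.1 htτ).le] at hs
        simp [not_le.2 hs.1]
      have hi : ∀ a b, IntervalIntegrable (fun s => (if s ≤ τ then A s else B (s - τ))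
          (if s ≤ τ then x s else y (s - τ))) volume a b := by
        refine intervalIntegrable_apply (L := L) (StronglyMeasurable.ite measurableSet_Iic hx.meas
          (hy.meas.comp_measurable (measurable_id.sub_const τ))) (fun t => hL _ ?_) ?_
        · split_ifs
          exacts [hx.mem _, hy.mem _]
        · refine hx.cont.if_le (hy.cont.comp (continuous_id.sub continuous_const)) continuous_id
            continuous_const fun t ht => ?_
          simp [ht, h0]
      rw [← intervalIntegral.integral_add_adjacent_intervals (hi 0 τ) (hi τ t), key2,
        key τ hτ le_rfl, intervalIntegral.integral_comp_sub_right (fun s => B s (y s)) τ]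
      have h1 := hx.eq τ hτ
      have h2 := hy.eq (t - τ) (by linarith)
      simp only [htτ, hτ, if_true, if_false, h2, sub_self]
      rw [← add_assoc, ← h1, h0]

end IsSolution

/-- The weight `e^{(2L+1)s}` makes the Picard operator contract by `1/2` on the whole half-line,
because `L ≤ (2L+1)/2`. -/
theorem norm_integral_exp_smul_apply_le (hA : ∀ t, ‖A t‖ ≤ L) {M : ℝ}
    (hx : ∀ t, ‖x t‖ ≤ M) {t : ℝ} (ht : 0 ≤ t) :
    ‖∫ s in (0 : ℝ)..t, Real.exp ((2 * L + 1) * s) • A s (x s)‖ ≤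
      M / 2 * Real.exp ((2 * L + 1) * t) := by
  have hL0 : 0 ≤ L := (norm_nonneg _).trans (hA 0)
  have hM0 : 0 ≤ M := (norm_nonneg _).trans (hx 0)
  have hd : ∀ s : ℝ, HasDerivAt (fun s => M / 2 * Real.exp ((2 * L + 1) * s))
      (M / 2 * (Real.exp ((2 * L + 1) * s) * (2 * L + 1))) s := fun s => by
    simpa using ((((hasDerivAt_id s).const_mul (2 * L + 1)).exp).const_mul (M / 2))
  have hc : Continuous fun s : ℝ => M / 2 * (Real.exp ((2 * L + 1) * s) * (2 * L + 1)) := by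
    fun_prop
  have h := intervalIntegral.integral_eq_sub_of_hasDerivAt (fun s _ => hd s)
    (hc.intervalIntegrable 0 t)
  calc _ ≤ ∫ s in (0 : ℝ)..t, M / 2 * (Real.exp ((2 * L + 1) * s) * (2 * L + 1)) := by
        refine intervalIntegral.norm_integral_le_of_norm_le ht (ae_of_all _ fun s _ => ?_)
          (hc.intervalIntegrable 0 t)
        rw [norm_smul, Real.norm_of_nonneg (Real.exp_pos _).le]
        have h1 : ‖A s (x s)‖ ≤ L * M :=
          ((A s).le_of_opNorm_le (hA s) _).trans (mul_le_mul_of_nonneg_left (hx s) hL0)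
        have h2 := mul_le_mul_of_nonneg_left h1 (Real.exp_pos ((2 * L + 1) * s)).le
        have h3 := mul_nonneg hM0 (Real.exp_pos ((2 * L + 1) * s)).le
        linarith
    _ ≤ _ := by
        rw [h]
        have : 0 ≤ M / 2 * Real.exp ((2 * L + 1) * 0) := by positivity
        linarith

/-- Existence of a solution of the linear equation with a measurable bounded law. -/
theorem exists_isSolution [CompleteSpace E] (hmem : ∀ t, A t ∈ 𝒞) (hA : StronglyMeasurable A)
    (hL : ∀ B ∈ 𝒞, ‖B‖ ≤ L) (v : E) : ∃ x, IsSolution 𝒞 A x ∧ x 0 = v := by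
  have hAL : ∀ t, ‖A t‖ ≤ L := fun t => hL _ (hmem t)
  have hL0 : 0 ≤ L := (norm_nonneg _).trans (hAL 0)
  -- The unknown of the fixed point problem is `y(t) = e^{-ct} x(t)`, which is bounded. Truncation
  -- by `max t 0` freezes the image at negative times.
  set c : ℝ := 2 * L + 1 with hc
  have hint : ∀ (y : BoundedContinuousFunction ℝ E) (a b : ℝ),
      IntervalIntegrable (fun s => Real.exp (c * s) • A s (y s)) volume a b := by
    intro y a b
    exact (intervalIntegrable_apply hA hAL y.continuous a b).continuousOn_smul
      (by fun_prop)
  have hcont : ∀ y : BoundedContinuousFunction ℝ E, Continuous fun t : ℝ =>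
      Real.exp (-(c * max t 0)) • (v + ∫ s in (0 : ℝ)..max t 0, Real.exp (c * s) • A s (y s)) := by
    intro y
    have h1 : Continuous fun t => ∫ s in (0 : ℝ)..t, Real.exp (c * s) • A s (y s) :=
      intervalIntegral.continuous_primitive (hint y) 0
    have h2 : Continuous fun t : ℝ => max t 0 := by fun_prop
    exact (by fun_prop : Continuous fun t : ℝ => Real.exp (-(c * max t 0))).smul
      (continuous_const.add (h1.comp h2))
  have hexp : ∀ t : ℝ, Real.exp (-(c * max t 0)) * Real.exp (c * max t 0) = 1 := fun t => by
    rw [← Real.exp_add, neg_add_cancel, Real.exp_zero]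
  have hbd : ∀ (y : BoundedContinuousFunction ℝ E) (t : ℝ), ‖Real.exp (-(c * max t 0)) •
      (∫ s in (0 : ℝ)..max t 0, Real.exp (c * s) • A s (y s))‖ ≤ ‖y‖ / 2 := by
    intro y t
    rw [norm_smul, Real.norm_of_nonneg (Real.exp_pos _).le]
    have := mul_le_mul_of_nonneg_left
      (norm_integral_exp_smul_apply_le hAL y.norm_coe_le_norm (le_max_right t 0))
      (Real.exp_pos (-(c * max t 0))).le
    rwa [mul_left_comm, hexp, mul_one] at this
  let F : BoundedContinuousFunction ℝ E → BoundedContinuousFunction ℝ E := fun y =>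
    BoundedContinuousFunction.ofNormedAddCommGroup _ (hcont y) (‖v‖ + ‖y‖ / 2) (fun t => by
      rw [smul_add]
      refine (norm_add_le _ _).trans (add_le_add ?_ (hbd y t))
      rw [norm_smul, Real.norm_of_nonneg (Real.exp_pos _).le]
      refine mul_le_of_le_one_left (norm_nonneg _) (Real.exp_le_one_iff.2 ?_)
      have : 0 ≤ c * max t 0 := mul_nonneg (by positivity) (le_max_right _ _)
      linarith)
  have hF : ContractingWith (1 / 2) F := by
    refine ⟨by
      rw [← NNReal.coe_lt_coe]; norm_num, LipschitzWith.of_dist_le_mul fun y z => ?_⟩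
    rw [BoundedContinuousFunction.dist_le (by positivity)]
    intro t
    have h1 : F y t - F z t = Real.exp (-(c * max t 0)) •
        (∫ s in (0 : ℝ)..max t 0, Real.exp (c * s) • A s ((y - z) s)) := by
      simp only [F, BoundedContinuousFunction.coe_ofNormedAddCommGroup,
        BoundedContinuousFunction.coe_sub, Pi.sub_apply, map_sub, smul_sub]
      rw [intervalIntegral.integral_sub (hint y _ _) (hint z _ _), smul_add, smul_add, smul_sub]
      abel
    rw [dist_eq_norm, h1, dist_eq_norm]
    refine (hbd (y - z) t).trans (le_of_eq ?_)
    push_cast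
    ring
  obtain ⟨y, hy⟩ : ∃ y, F y = y := ⟨_, hF.fixedPoint_isFixedPt⟩
  have hyt : ∀ t, 0 ≤ t → Real.exp (c * t) • y t =
      v + ∫ s in (0 : ℝ)..t, Real.exp (c * s) • A s (y s) := by
    intro t ht
    have h1 : y t = F y t := by rw [hy]
    have h2 := hexp t
    rw [max_eq_left ht, mul_comm] at h2
    rw [h1]
    simp only [F, BoundedContinuousFunction.coe_ofNormedAddCommGroup, max_eq_left ht]
    rw [smul_smul, h2, one_smul]
  have h0 : Real.exp (c * 0) • y 0 = v := by simpa using hyt 0 le_rfl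
  refine ⟨fun t => Real.exp (c * t) • y t, ⟨hmem, hA, ?_, fun t ht => ?_⟩, h0⟩
  · exact (by fun_prop : Continuous fun t : ℝ => Real.exp (c * t)).smul y.continuous
  · simp only [h0, map_smul]
    exact hyt t ht

end SwitchingSystem

/-! ### Compactness of the set of solutions. -/

namespace SwitchingSystem

variable {E : Type*} [NormedAddCommGroup E] [NormedSpace ℝ E]

variable {𝒞 : Set (E →L[ℝ] E)} {A : ℝ → E →L[ℝ] E} {x : ℝ → E} {L : ℝ}

theorem exists_tendsto_ultrafilter {V ι : Type*} [SeminormedAddCommGroup V] [ProperSpace V]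
    (F : Ultrafilter ι) {u : ι → V} {R : ℝ} (hu : ∀ n, ‖u n‖ ≤ R) :
    ∃ v, Tendsto u F (𝓝 v) := by
  obtain ⟨v, -, hv⟩ := (isCompact_closedBall (0 : V) R).ultrafilter_le_nhds (F.map u) (by
    rw [Ultrafilter.coe_map, le_principal_iff, mem_map]
    exact Eventually.of_forall fun n => by simpa using hu n)
  exact ⟨v, hv⟩

/-- The slope is an average of values of the law. This constraint on the primitive survives
pointwise limits, even when the laws themselves do not converge. -/
theorem slope_integral_mem [CompleteSpace E] (hconv : Convex ℝ 𝒞) (hclosed : IsClosed 𝒞)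
    (hmem : ∀ t, A t ∈ 𝒞) (hA : ∀ a b, IntervalIntegrable A volume a b) {s t : ℝ} (hst : s ≠ t) :
    slope (fun t => ∫ r in (0 : ℝ)..t, A r) s t ∈ 𝒞 := by
  wlog h : s < t generalizing s t
  · rw [slope_comm]
    exact this hst.symm (lt_of_le_of_ne (not_lt.1 h) hst.symm)
  rw [slope_def_module, intervalIntegral.integral_interval_sub_left (hA _ _) (hA _ _),
    ← interval_average_eq]
  refine hconv.set_average_mem hclosed ?_ ?_ (ae_of_all _ hmem) ?_
  · simp [uIoc_of_le h.le, h]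
  · simp [uIoc_of_le h.le]
  · rw [← intervalIntegrable_iff]
    exact hA s t

namespace IsSolution

theorem norm_le_of_le (h : IsSolution 𝒞 A x) (hL : ∀ B ∈ 𝒞, ‖B‖ ≤ L) {R T t : ℝ}
    (hR : ‖x 0‖ ≤ R) (ht : t ∈ Icc 0 T) : ‖x t‖ ≤ R * Real.exp (L * T) := by
  have hL0 : 0 ≤ L := (norm_nonneg _).trans (hL _ (h.mem 0))
  have hR0 : 0 ≤ R := (norm_nonneg _).trans hR
  refine (h.norm_le hL ht.1).trans (mul_le_mul hR (Real.exp_le_exp.2 ?_) (Real.exp_pos _).le hR0)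
  exact mul_le_mul_of_nonneg_left ht.2 hL0

theorem norm_sub_le (h : IsSolution 𝒞 A x) (hL : ∀ B ∈ 𝒞, ‖B‖ ≤ L) {R T s t : ℝ}
    (hR : ‖x 0‖ ≤ R) (hs : s ∈ Icc 0 T) (ht : t ∈ Icc 0 T) :
    ‖x t - x s‖ ≤ L * (R * Real.exp (L * T)) * |t - s| := by
  have hL0 : 0 ≤ L := (norm_nonneg _).trans (hL _ (h.mem 0))
  rw [h.sub_eq hL hs.1 ht.1]
  refine intervalIntegral.norm_integral_le_of_norm_le_const fun r hr => ?_
  have hr' : r ∈ Icc 0 T := uIcc_subset_Icc hs ht (uIoc_subset_uIcc hr)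
  exact ((A r).le_of_opNorm_le (hL _ (h.mem r)) _).trans
    (mul_le_mul_of_nonneg_left (h.norm_le_of_le hL hR hr') hL0)

/-- Freezing the state at time `s` costs a second-order error. The constant depends only on `L`,
`R`, `T`, so the estimate passes to limits of solutions and primitives. -/
theorem norm_sub_sub_le [CompleteSpace E] (h : IsSolution 𝒞 A x) (hL : ∀ B ∈ 𝒞, ‖B‖ ≤ L)
    (hA : ∀ a b, IntervalIntegrable A volume a b) {R T s t : ℝ}
    (hR : ‖x 0‖ ≤ R) (hs : s ∈ Icc 0 T) (ht : t ∈ Icc 0 T) :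
    ‖x t - x s - ((∫ r in (0 : ℝ)..t, A r) - ∫ r in (0 : ℝ)..s, A r) (x s)‖ ≤
      L * (L * (R * Real.exp (L * T))) * |t - s| ^ 2 := by
  have hL0 : 0 ≤ L := (norm_nonneg _).trans (hL _ (h.mem 0))
  have hR0 : 0 ≤ R := (norm_nonneg _).trans hR
  rw [h.sub_eq hL hs.1 ht.1, intervalIntegral.integral_interval_sub_left (hA _ _) (hA _ _),
    ContinuousLinearMap.intervalIntegral_apply (hA _ _), ← intervalIntegral.integral_sub
      (h.intervalIntegrable hL _ _)
      (intervalIntegrable_apply h.meas (fun t => hL _ (h.mem t)) continuous_const _ _)]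
  have : L * (L * (R * Real.exp (L * T))) * |t - s| ^ 2 =
    (L * (L * (R * Real.exp (L * T)) * |t - s|)) * |t - s| := by ring
  rw [this]
  refine intervalIntegral.norm_integral_le_of_norm_le_const fun r hr => ?_
  have hr' : r ∈ Icc 0 T := uIcc_subset_Icc hs ht (uIoc_subset_uIcc hr)
  rw [← map_sub]
  refine ((A r).le_of_opNorm_le (hL _ (h.mem r)) _).trans (mul_le_mul_of_nonneg_left ?_ hL0)
  refine (h.norm_sub_le hL hR hs hr').trans (mul_le_mul_of_nonneg_left ?_ (by positivity))
  exact abs_sub_left_of_mem_uIcc (uIoc_subset_uIcc hr)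

end IsSolution

/-- A pointwise limit of solutions along an ultrafilter is a solution; here the convexity of the
control set enters. -/
theorem exists_isSolution_tendsto [FiniteDimensional ℝ E] (hconv : Convex ℝ 𝒞)
    (hclosed : IsClosed 𝒞) (hL : ∀ B ∈ 𝒞, ‖B‖ ≤ L) {ι : Type*} (F : Ultrafilter ι)
    {A : ι → ℝ → E →L[ℝ] E} {x : ι → ℝ → E} (h : ∀ n, IsSolution 𝒞 (A n) (x n)) {R : ℝ}
    (hR : ∀ n, ‖x n 0‖ ≤ R) :
    ∃ B y, IsSolution 𝒞 B y ∧ ∀ t, 0 ≤ t → Tendsto (fun n => x n t) F (𝓝 (y t)) := by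
  have : CompleteSpace E := FiniteDimensional.complete ℝ E
  have : ProperSpace E := FiniteDimensional.proper ℝ E
  have : ProperSpace (E →L[ℝ] E) := FiniteDimensional.proper ℝ _
  obtain ⟨n₀⟩ : Nonempty ι := F.neBot.nonempty
  have hL0 : 0 ≤ L := (norm_nonneg _).trans (hL _ ((h n₀).mem 0))
  have hR0 : 0 ≤ R := (norm_nonneg _).trans (hR n₀)
  have hA : ∀ n a b, IntervalIntegrable (A n) volume a b := fun n a b =>
    (intervalIntegrable_const (c := L)).mono_fun (h n).meas.aestronglyMeasurable
      (ae_of_all _ fun s => (hL _ ((h n).mem s)).trans (le_abs_self _))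
  have hPn : ∀ n s t, ‖(∫ r in (0 : ℝ)..t, A n r) - ∫ r in (0 : ℝ)..s, A n r‖ ≤ L * |t - s| := by
    intro n s t
    rw [intervalIntegral.integral_interval_sub_left (hA n _ _) (hA n _ _)]
    exact intervalIntegral.norm_integral_le_of_norm_le_const fun r _ => hL _ ((h n).mem r)
  -- Limits are taken of the primitives of the laws; the limit law will be the derivative of `P`.
  have hPlim : ∀ t, ∃ B, Tendsto (fun n => ∫ r in (0 : ℝ)..t, A n r) F (𝓝 B) := fun t =>
    exists_tendsto_ultrafilter F (R := L * |t - 0|) fun n => by simpa using hPn n 0 t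
  choose P hP using hPlim
  have hxlim : ∀ t : ℝ, ∃ v, Tendsto (fun n => x n (max t 0)) F (𝓝 v) := fun t =>
    exists_tendsto_ultrafilter F fun n =>
      (h n).norm_le_of_le hL (hR n) ⟨le_max_right t 0, le_rfl⟩
  choose y hy using hxlim
  have hy' : ∀ t, 0 ≤ t → Tendsto (fun n => x n t) F (𝓝 (y t)) := fun t ht => by
    simpa [max_eq_left ht] using hy t
  have hPlip : LipschitzWith L.toNNReal P := LipschitzWith.of_dist_le_mul fun t s => by
    rw [dist_eq_norm, Real.dist_eq, Real.coe_toNNReal _ hL0]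
    exact le_of_tendsto ((hP t).sub (hP s)).norm (Eventually.of_forall fun n => hPn n s t)
  have hslope : ∀ s t, s ≠ t → slope P s t ∈ 𝒞 := by
    intro s t hst
    refine hclosed.mem_of_tendsto (f := fun n => slope (fun t => ∫ r in (0 : ℝ)..t, A n r) s t)
      (b := (F : Filter ι)) ?_
      (Eventually.of_forall fun n => slope_integral_mem hconv hclosed (h n).mem (hA n) hst)
    simp only [slope_def_module]
    exact ((hP t).sub (hP s)).const_smul _
  set M : ℝ → ℝ := fun T => L * (R * Real.exp (L * T)) with hM
  have hM0 : ∀ T, 0 ≤ M T := fun T => by positivity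
  have hylip : ∀ T, LipschitzOnWith (M T).toNNReal y (Iic T) := fun T =>
    LipschitzOnWith.of_dist_le_mul fun t ht s hs => by
      rw [dist_eq_norm, Real.dist_eq, Real.coe_toNNReal _ (hM0 T)]
      rcases le_or_gt 0 T with hT | hT
      · refine le_of_tendsto ((hy t).sub (hy s)).norm (Eventually.of_forall fun n => ?_)
        refine ((h n).norm_sub_le hL (hR n) (T := T) ⟨le_max_right _ _, max_le hs hT⟩
          ⟨le_max_right _ _, max_le ht hT⟩).trans ?_
        exact mul_le_mul_of_nonneg_left (abs_max_sub_max_le_abs _ _ _) (hM0 T)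
      · have h1 : y t = y s := by
          have h2 := hy s
          rw [max_eq_right (le_trans hs hT.le), ← max_eq_right (le_trans ht hT.le)] at h2
          exact tendsto_nhds_unique (hy t) h2
        rw [h1, sub_self, norm_zero]
        exact mul_nonneg (hM0 T) (abs_nonneg _)
  have hyc : Continuous y := continuous_iff_continuousAt.2 fun t =>
    (hylip (t + 1)).continuousOn.continuousAt (Iic_mem_nhds (lt_add_one t))
  have htaylor : ∀ T, ∀ s ∈ Icc 0 T, ∀ t ∈ Icc 0 T,
      ‖y t - y s - (P t - P s) (y s)‖ ≤ L * M T * |t - s| ^ 2 := by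
    intro T s hs t ht
    have h1 := (isBoundedBilinearMap_apply (𝕜 := ℝ) (E := E) (F := E)).continuous.tendsto
      (P t - P s, y s) |>.comp (((hP t).sub (hP s)).prodMk_nhds (hy' s hs.1))
    refine le_of_tendsto (((hy' t ht.1).sub (hy' s hs.1)).sub h1).norm
      (Eventually.of_forall fun n => ?_)
    exact (h n).norm_sub_sub_le hL (hA n) (hR n) hs ht
  classical
  -- `P` is Lipschitz, hence differentiable almost everywhere; elsewhere the default `A n₀ 0` keeps
  -- `B` inside `𝒞`.
  let B : ℝ → E →L[ℝ] E := fun t => if DifferentiableAt ℝ P t then deriv P t else A n₀ 0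
  have hBmem : ∀ t, B t ∈ 𝒞 := by
    intro t
    by_cases hd : DifferentiableAt ℝ P t
    · simp only [B, hd, if_true]
      have := hasDerivAt_iff_tendsto_slope.1 hd.hasDerivAt
      refine hclosed.mem_of_tendsto this ?_
      filter_upwards [self_mem_nhdsWithin] with z hz
      exact hslope t z (Ne.symm hz)
    · simp only [B, hd, if_false]
      exact (h n₀).mem 0
  have hBmeas : StronglyMeasurable B :=
    StronglyMeasurable.ite (measurableSet_of_differentiableAt ℝ P) (stronglyMeasurable_deriv P)
      stronglyMeasurable_const
  have hyd : ∀ s, 0 < s → DifferentiableAt ℝ P s → HasDerivAt y (B s (y s)) s := by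
    intro s hs hd
    have hB : HasDerivAt P (B s) s := by simpa only [B, hd, if_true] using hd.hasDerivAt
    -- By `htaylor` the increment is quadratic in `t - s`.
    have h1 : HasDerivAt (fun t => y t - P t (y s)) 0 s := by
      have : (fun t => (y t - P t (y s)) - (y s - P s (y s))) =O[𝓝 s] fun t => ‖t - s‖ ^ 2 := by
        refine Asymptotics.IsBigO.of_bound (L * M (s + 1)) ?_
        filter_upwards [Ioo_mem_nhds hs (lt_add_one s)] with t ht
        have := htaylor (s + 1) s ⟨hs.le, by linarith⟩ t ⟨ht.1.le, ht.2.le⟩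
        rw [norm_pow, norm_norm, Real.norm_eq_abs]
        refine le_trans (le_of_eq ?_) this
        congr 1
        rw [sub_apply]
        abel
      have := this.hasFDerivAt (𝕜 := ℝ) one_lt_two
      simpa using this.hasDerivAt
    have h2 : HasDerivAt (fun t => P t (y s)) (B s (y s)) s := by
      simpa using hB.clm_apply (hasDerivAt_const s (y s))
    have h3 := h1.add h2
    rw [zero_add] at h3
    exact h3.congr_of_eventuallyEq (Eventually.of_forall fun t => (sub_add_cancel _ _).symm)
  refine ⟨B, y, ⟨hBmem, hBmeas, hyc, fun T hT => ?_⟩, hy'⟩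
  have hint : ∀ a b, IntervalIntegrable (fun s => B s (y s)) volume a b :=
    intervalIntegrable_apply hBmeas (fun t => hL _ (hBmem t)) hyc
  -- The derivative of this difference vanishes only almost everywhere, so absolute continuity is
  -- needed to conclude that it is constant. Both terms are Lipschitz on `[0, T]`.
  have hac : AbsolutelyContinuousOnInterval
      (fun t => y t - ∫ s in (0 : ℝ)..t, B s (y s)) 0 T := by
    refine LipschitzOnWith.absolutelyContinuousOnInterval (K := (M T).toNNReal) ?_ |>.sub
      (LipschitzOnWith.absolutelyContinuousOnInterval (K := (M T).toNNReal) ?_)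
    · rw [uIcc_of_le hT]
      exact (hylip T).mono Icc_subset_Iic_self
    · rw [uIcc_of_le hT]
      refine LipschitzOnWith.of_dist_le_mul fun t ht s hs => ?_
      rw [dist_eq_norm, Real.dist_eq, Real.coe_toNNReal _ (hM0 T),
        intervalIntegral.integral_interval_sub_left (hint _ _) (hint _ _)]
      refine intervalIntegral.norm_integral_le_of_norm_le_const fun r hr => ?_
      have hr' : r ∈ Icc 0 T := uIcc_subset_Icc hs ht (uIoc_subset_uIcc hr)
      refine ((B r).le_of_opNorm_le (hL _ (hBmem r)) _).trans (mul_le_mul_of_nonneg_left ?_ hL0)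
      exact le_of_tendsto (hy' r hr'.1).norm
        (Eventually.of_forall fun n => (h n).norm_le_of_le hL (hR n) hr')
  obtain ⟨C, hC⟩ := hac.const_of_ae_hasDerivAt_zero (by
    filter_upwards [hPlip.ae_differentiableAt_real, (hint 0 T).ae_hasDerivAt_integral,
      Measure.ae_ne volume 0] with s hs1 hs2 hs3 hs
    have hs0 : 0 < s := by
      rw [uIcc_of_le hT] at hs
      exact lt_of_le_of_ne hs.1 (Ne.symm hs3)
    have h1 := (hyd s hs0 hs1).sub (hs2 hs 0 (by simp))
    rwa [sub_self] at h1)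
  have h0 := hC 0 (by simp)
  have h1 := hC T (by simp)
  simp only [intervalIntegral.integral_same, sub_zero] at h0
  rw [h0, ← h1, sub_add_cancel]

end SwitchingSystem

/-! ### Growth rates, and boundedness of the rescaled solutions. -/

namespace SwitchingSystem

variable {E : Type*} [NormedAddCommGroup E] [NormedSpace ℝ E]

variable {𝒞 : Set (E →L[ℝ] E)} {A : ℝ → E →L[ℝ] E} {x : ℝ → E} {L σ : ℝ}

theorem seminorm_continuous [FiniteDimensional ℝ E] (p : Seminorm ℝ E) : Continuous p :=
  continuousOn_univ.1 (p.convexOn.continuousOn isOpen_univ)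

theorem exists_seminorm_le_mul_norm [FiniteDimensional ℝ E] (p : Seminorm ℝ E) :
    ∃ K, 0 < K ∧ ∀ v, p v ≤ K * ‖v‖ :=
  p.bound_of_continuous_normedSpace (seminorm_continuous p)

theorem exists_norm_le_mul_seminorm [FiniteDimensional ℝ E] (p : Seminorm ℝ E)
    (hp : ∀ v, p v = 0 → v = 0) : ∃ K, 0 < K ∧ ∀ v, ‖v‖ ≤ K * p v := by
  have : ProperSpace E := FiniteDimensional.proper ℝ E
  rcases subsingleton_or_nontrivial E with hE | hE
  · exact ⟨1, one_pos, fun v => by simp [Subsingleton.elim v 0]⟩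
  obtain ⟨u, hu, hmin⟩ := (isCompact_sphere (0 : E) 1).exists_isMinOn
    (NormedSpace.sphere_nonempty.2 zero_le_one) (seminorm_continuous p).continuousOn
  have hu0 : 0 < p u := by
    refine lt_of_le_of_ne (apply_nonneg p u) fun h => ?_
    simp [hp u h.symm] at hu
  refine ⟨(p u)⁻¹, inv_pos.2 hu0, fun v => ?_⟩
  rcases eq_or_ne v 0 with rfl | hv
  · simp
  have hv' : 0 < ‖v‖ := norm_pos_iff.2 hv
  have h1 : p u ≤ p (‖v‖⁻¹ • v) := hmin (by simp [norm_smul, hv'.ne'])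
  rw [map_smul_eq_mul, norm_inv, norm_norm, ← div_eq_inv_mul, le_div_iff₀ hv'] at h1
  rw [← div_eq_inv_mul, le_div_iff₀ hu0]
  linarith

theorem exists_isSolution_of_nonempty [CompleteSpace E] (hne : 𝒞.Nonempty)
    (hL : ∀ B ∈ 𝒞, ‖B‖ ≤ L) (v : E) : ∃ A x, IsSolution 𝒞 A x ∧ x 0 = v := by
  obtain ⟨B, hB⟩ := hne
  exact ⟨fun _ => B, exists_isSolution (fun _ => hB) stronglyMeasurable_const hL v⟩

/-- Only the values of the concatenated solution matter from here on, so its law is hidden. -/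
theorem IsSolution.exists_concat {B : ℝ → E →L[ℝ] E} {y : ℝ → E} (hx : IsSolution 𝒞 A x)
    (hy : IsSolution 𝒞 B y) (hL : ∀ B ∈ 𝒞, ‖B‖ ≤ L) {τ : ℝ} (hτ : 0 ≤ τ) (h0 : y 0 = x τ) :
    ∃ D z, IsSolution 𝒞 D z ∧ (∀ t, t ≤ τ → z t = x t) ∧ ∀ t, 0 ≤ t → z (τ + t) = y t := by
  refine ⟨_, _, hx.concat hy hL hτ h0, fun t ht => if_pos ht, fun t ht => ?_⟩
  split_ifs with hle
  · have : t = 0 := le_antisymm (by linarith) ht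
    rw [this, add_zero, h0]
  · rw [add_sub_cancel_left]

/-- A subspace which is invariant for the solutions is invariant for the control operators. -/
theorem apply_mem_of_forall_isSolution [FiniteDimensional ℝ E] (hL : ∀ B ∈ 𝒞, ‖B‖ ≤ L)
    (W : Submodule ℝ E)
    (hW : ∀ A x, IsSolution 𝒞 A x → x 0 ∈ W → ∀ t, 0 ≤ t → x t ∈ W) :
    ∀ B ∈ 𝒞, ∀ v ∈ W, B v ∈ W := by
  intro B hB v hv
  have : CompleteSpace E := FiniteDimensional.complete ℝ E
  obtain ⟨x, hx, rfl⟩ := exists_isSolution (A := fun _ => B) (fun _ => hB)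
    stronglyMeasurable_const hL v
  -- `B v` is the velocity at time `0` under the constant law `B`, thus a limit of difference
  -- quotients lying in the closed subspace `W`.
  have hd : HasDerivAt (fun t => x 0 + ∫ s in (0 : ℝ)..t, B (x s)) (B (x 0)) 0 :=
    ((B.continuous.comp hx.cont).integral_hasStrictDerivAt 0 0).hasDerivAt.const_add _
  refine W.closed_of_finiteDimensional.mem_of_tendsto hd.tendsto_slope_zero_right ?_
  filter_upwards [self_mem_nhdsWithin] with t ht
  have ht' : 0 ≤ t := le_of_lt ht
  rw [zero_add, ← hx.eq t ht', intervalIntegral.integral_same, add_zero]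
  exact W.smul_mem _ (W.sub_mem (hW _ x hx hv t ht') hv)

/-- The rates `s` such that every solution is `O(e^{st})`; the Lyapunov exponent is their
infimum. -/
def growthRates (𝒞 : Set (E →L[ℝ] E)) : Set ℝ :=
  {s | ∀ A x, IsSolution 𝒞 A x → ∃ C : ℝ, ∀ t, 0 ≤ t → ‖x t‖ ≤ C * Real.exp (s * t)}

/-- `L` is a growth rate and `-L` a lower bound; the latter needs one nonzero solution, hence a
nonempty `𝒞`. -/
theorem isGLB_sInf_growthRates [CompleteSpace E] [Nontrivial E] (hne : 𝒞.Nonempty)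
    (hL : ∀ B ∈ 𝒞, ‖B‖ ≤ L) : IsGLB (growthRates 𝒞) (sInf (growthRates 𝒞)) := by
  refine isGLB_csInf ⟨L, fun A x h => ⟨‖x 0‖, fun t ht => h.norm_le hL ht⟩⟩ ⟨-L, fun s hs => ?_⟩
  obtain ⟨v, hv⟩ := exists_ne (0 : E)
  obtain ⟨A, x, hx, rfl⟩ := exists_isSolution_of_nonempty hne hL v
  obtain ⟨C, hC⟩ := hs A x hx
  by_contra hlt
  have h1 : ∀ t, 0 ≤ t → ‖x 0‖ ≤ C * Real.exp ((s + L) * t) := fun t ht => by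
    refine (hx.norm_zero_le hL ht).trans ?_
    have := mul_le_mul_of_nonneg_right (hC t ht) (Real.exp_pos (L * t)).le
    rwa [mul_assoc, ← Real.exp_add, ← add_mul] at this
  have h2 : Tendsto (fun t => C * Real.exp ((s + L) * t)) atTop (𝓝 (C * 0)) := by
    refine (Real.tendsto_exp_atBot.comp ?_).const_mul C
    exact tendsto_id.const_mul_atTop_of_neg (by linarith)
  rw [mul_zero] at h2
  have h3 : ‖x 0‖ ≤ 0 := ge_of_tendsto h2 (by
    filter_upwards [eventually_ge_atTop 0] with t ht using h1 t ht)
  exact hv (norm_le_zero_iff.1 h3)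

/-- If from every nonzero point there start solutions which are unbounded after rescaling by
`e^{-σt}`, then a fixed growth factor is attained within uniformly bounded time. -/
theorem exists_uniform_time [FiniteDimensional ℝ E] (hne : 𝒞.Nonempty) (hL : ∀ B ∈ 𝒞, ‖B‖ ≤ L)
    (h : ∀ v : E, v ≠ 0 → ∀ K : ℝ, ∃ A x t, IsSolution 𝒞 A x ∧ x 0 = v ∧ 0 ≤ t ∧
      K < Real.exp (-(σ * t)) * ‖x t‖) :
    ∃ T, 0 ≤ T ∧ ∀ v : E, ∃ A x t, IsSolution 𝒞 A x ∧ x 0 = v ∧ t ∈ Icc 0 T ∧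
      2 * ‖v‖ ≤ Real.exp (-(σ * t)) * ‖x t‖ := by
  have : CompleteSpace E := FiniteDimensional.complete ℝ E
  have : ProperSpace E := FiniteDimensional.proper ℝ E
  have key : ∃ T, 0 ≤ T ∧ ∀ v ∈ Metric.sphere (0 : E) 1, ∃ A x t, IsSolution 𝒞 A x ∧ x 0 = v ∧
      t ∈ Icc 0 T ∧ 2 ≤ Real.exp (-(σ * t)) * ‖x t‖ := by
    refine (isCompact_sphere (0 : E) 1).induction_on
      (p := fun S => ∃ T, 0 ≤ T ∧ ∀ v ∈ S, ∃ A x t, IsSolution 𝒞 A x ∧ x 0 = v ∧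
      t ∈ Icc 0 T ∧ 2 ≤ Real.exp (-(σ * t)) * ‖x t‖) ⟨0, le_rfl, by simp⟩ ?_ ?_ ?_
    · rintro S S' hSS ⟨T, hT, h⟩
      exact ⟨T, hT, fun v hv => h v (hSS hv)⟩
    · rintro S S' ⟨T, hT, h⟩ ⟨T', hT', h'⟩
      refine ⟨max T T', hT.trans (le_max_left _ _), fun v hv => ?_⟩
      rcases hv with hv | hv
      · obtain ⟨A, x, t, h1, h2, h3, h4⟩ := h v hv
        exact ⟨A, x, t, h1, h2, ⟨h3.1, h3.2.trans (le_max_left _ _)⟩, h4⟩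
      · obtain ⟨A, x, t, h1, h2, h3, h4⟩ := h' v hv
        exact ⟨A, x, t, h1, h2, ⟨h3.1, h3.2.trans (le_max_right _ _)⟩, h4⟩
    · intro v hv
      obtain ⟨A, x, t, hx, rfl, ht, hxt⟩ := h v (by rintro rfl; simp at hv) 2
      have hc : Continuous fun u : E =>
          Real.exp (-(σ * t)) * (‖x t‖ - ‖u - x 0‖ * Real.exp (L * t)) := by fun_prop
      have hev : ∀ᶠ u in 𝓝 (x 0),
          2 < Real.exp (-(σ * t)) * (‖x t‖ - ‖u - x 0‖ * Real.exp (L * t)) :=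
        hc.continuousAt.eventually (lt_mem_nhds (by simpa using hxt))
      refine ⟨_, mem_nhdsWithin_of_mem_nhds hev, t, ht, fun u hu => ?_⟩
      obtain ⟨y, hy, rfl⟩ := exists_isSolution hx.mem hx.meas hL u
      refine ⟨A, y, t, hy, rfl, ⟨ht, le_rfl⟩, (le_of_lt hu).trans ?_⟩
      refine mul_le_mul_of_nonneg_left ?_ (Real.exp_pos _).le
      have h1 := (hy.sub hx hL).norm_le hL ht
      have h2 := norm_sub_norm_le (x t) (y t)
      rw [norm_sub_rev] at h2
      linarith
  obtain ⟨T, hT, hkey⟩ := key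
  refine ⟨T, hT, fun v => ?_⟩
  rcases eq_or_ne v 0 with rfl | hv
  · obtain ⟨A, x, hx, h0⟩ := exists_isSolution_of_nonempty hne hL (0 : E)
    refine ⟨A, x, 0, hx, h0, ⟨le_rfl, hT⟩, ?_⟩
    rw [norm_zero, mul_zero]
    positivity
  · have hv' : 0 < ‖v‖ := norm_pos_iff.2 hv
    obtain ⟨A, x, t, hx, h0, ht, hxt⟩ := hkey (‖v‖⁻¹ • v) (by simp [norm_smul, hv'.ne'])
    refine ⟨A, fun t => ‖v‖ • x t, t, hx.const_smul _, ?_, ht, ?_⟩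
    · simp only [h0, smul_smul]
      rw [mul_inv_cancel₀ hv'.ne', one_smul]
    · rw [norm_smul, norm_norm]
      nlinarith

/-- A growth factor `2` after rescaling by `e^{-σt}` cannot be attained from every point within
uniformly bounded time. -/
theorem not_uniform_growth [FiniteDimensional ℝ E] [Nontrivial E] (hne : 𝒞.Nonempty)
    (hconv : Convex ℝ 𝒞) (hclosed : IsClosed 𝒞) (hL : ∀ B ∈ 𝒞, ‖B‖ ≤ L)
    (hσ : IsGLB (growthRates 𝒞) σ) {T : ℝ} (hT : 0 ≤ T)
    (h : ∀ v : E, ∃ A x t, IsSolution 𝒞 A x ∧ x 0 = v ∧ t ∈ Icc 0 T ∧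
      2 * ‖v‖ ≤ Real.exp (-(σ * t)) * ‖x t‖) : False := by
  have : CompleteSpace E := FiniteDimensional.complete ℝ E
  obtain ⟨v, hv⟩ := exists_ne (0 : E)
  obtain ⟨A₀, x₀, hx₀, h0⟩ := exists_isSolution_of_nonempty hne hL v
  -- An element is a law, a solution and a marked time. Each step keeps the solution up to the
  -- marked time and then continues it until the rescaled norm has at least doubled.
  let X := {p : (ℝ → E →L[ℝ] E) × (ℝ → E) × ℝ // IsSolution 𝒞 p.1 p.2.1 ∧ 0 ≤ p.2.2}
  have hstep : ∀ p : X, ∃ q : X, (∀ t, t ≤ p.1.2.2 → q.1.2.1 t = p.1.2.1 t) ∧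
      q.1.2.2 ∈ Icc p.1.2.2 (p.1.2.2 + T) ∧
      2 * (Real.exp (-(σ * p.1.2.2)) * ‖p.1.2.1 p.1.2.2‖) ≤
        Real.exp (-(σ * q.1.2.2)) * ‖q.1.2.1 q.1.2.2‖ := by
    rintro ⟨⟨A, x, τ⟩, hx, hτ⟩
    obtain ⟨B, y, t, hy, hy0, ht, hyt⟩ := h (x τ)
    obtain ⟨D, z, hz, hz1, hz2⟩ := hx.exists_concat hy hL hτ hy0
    refine ⟨⟨⟨D, z, τ + t⟩, hz, add_nonneg hτ ht.1⟩, hz1, ?_, ?_⟩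
    · exact ⟨by simpa using ht.1, by simpa using ht.2⟩
    · have h2 := mul_le_mul_of_nonneg_left hyt (Real.exp_pos (-(σ * τ))).le
      rw [← mul_assoc (Real.exp _) (Real.exp _), ← Real.exp_add] at h2
      have h3 : -(σ * (τ + t)) = -(σ * τ) + -(σ * t) := by ring
      simp only [hz2 t ht.1, h3]
      linarith
  choose next hnext1 hnext2 hnext3 using hstep
  let u : ℕ → X := fun n => n.rec ⟨⟨A₀, x₀, 0⟩, hx₀, le_rfl⟩ fun _ p => next p
  let τ : ℕ → ℝ := fun n => (u n).1.2.2
  have hτmono : Monotone τ := monotone_nat_of_le_succ fun n => (hnext2 (u n)).1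
  have hτle : ∀ n : ℕ, τ n ≤ n * T := by
    intro n
    induction n with
    | zero => simp [τ, u]
    | succ n ih =>
      have : τ (n + 1) ≤ τ n + T := (hnext2 (u n)).2
      push_cast
      linarith
  have hagree : ∀ n m, n ≤ m → ∀ t, t ≤ τ n → (u m).1.2.1 t = (u n).1.2.1 t := by
    intro n m hnm
    induction m, hnm using Nat.le_induction with
    | base => intros; rfl
    | succ m hnm ih =>
      intro t ht
      rw [← ih t ht]
      exact hnext1 (u m) t (ht.trans (hτmono hnm))
  have hgrow : ∀ n, 2 ^ n * ‖v‖ ≤ Real.exp (-(σ * τ n)) * ‖(u n).1.2.1 (τ n)‖ := by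
    intro n
    induction n with
    | zero => simp [τ, u, h0]
    | succ n ih =>
      have : 2 * (Real.exp (-(σ * τ n)) * ‖(u n).1.2.1 (τ n)‖) ≤
        Real.exp (-(σ * τ (n + 1))) * ‖(u (n + 1)).1.2.1 (τ (n + 1))‖ := hnext3 (u n)
      rw [pow_succ]
      linarith
  have hR : ∀ n, ‖(u n).1.2.1 0‖ ≤ ‖v‖ := fun n => by
    rw [hagree 0 n (Nat.zero_le n) 0 le_rfl]
    exact le_of_eq (congrArg norm h0)
  -- The iterates agree up to ever later marked times, so the limit is one solution passing through
  -- all the marked points, even if the times `τ n` stay bounded.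
  obtain ⟨B, y, hy, hlim⟩ := exists_isSolution_tendsto hconv hclosed hL (hyperfilter ℕ)
    (fun n => (u n).2.1) hR
  have hyτ : ∀ n, y (τ n) = (u n).1.2.1 (τ n) := by
    intro n
    refine tendsto_nhds_unique (hlim (τ n) (u n).2.2) (tendsto_const_nhds.congr' ?_)
    filter_upwards [Nat.hyperfilter_le_atTop (eventually_ge_atTop n)] with m hm
    exact (hagree n m hm _ le_rfl).symm
  -- With this `ε`, a rate below `σ + ε` allows at most a factor `√2` per step, against the factor
  -- `2` obtained. `T + 1` avoids division by zero.
  set ε : ℝ := Real.log 2 / 2 / (T + 1) with hε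
  have hlog : 0 < Real.log 2 := Real.log_pos one_lt_two
  have hε0 : 0 < ε := by positivity
  obtain ⟨s, hs, -, hsσ⟩ := hσ.exists_between (lt_add_of_pos_right σ hε0)
  obtain ⟨C, hC⟩ := hs B y hy
  set q : ℝ := Real.exp (Real.log 2 / 2) with hq
  have hq2 : q * q = 2 := by
    rw [hq, ← Real.exp_add, add_halves, Real.exp_log two_pos]
  have hq1 : 1 < q := Real.one_lt_exp_iff.2 (by positivity)
  have hqpos : 0 < q := Real.exp_pos _
  have hbound : ∀ n : ℕ, q ^ n * ‖v‖ ≤ |C| := by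
    intro n
    have hτ0 : 0 ≤ τ n := (u n).2.2
    have h1 : 2 ^ n * ‖v‖ ≤ |C| * q ^ n := by
      calc 2 ^ n * ‖v‖ ≤ Real.exp (-(σ * τ n)) * ‖y (τ n)‖ := by rw [hyτ]; exact hgrow n
        _ ≤ Real.exp (-(σ * τ n)) * (|C| * Real.exp (s * τ n)) := by
          refine mul_le_mul_of_nonneg_left ((hC _ hτ0).trans ?_) (Real.exp_pos _).le
          exact mul_le_mul_of_nonneg_right (le_abs_self C) (Real.exp_pos _).le
        _ = |C| * Real.exp ((s - σ) * τ n) := by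
          rw [mul_left_comm, ← Real.exp_add]
          ring_nf
        _ ≤ |C| * q ^ n := by
          refine mul_le_mul_of_nonneg_left ?_ (abs_nonneg C)
          rw [hq, ← Real.exp_nat_mul]
          refine Real.exp_le_exp.2 ?_
          calc (s - σ) * τ n ≤ ε * τ n := mul_le_mul_of_nonneg_right (by linarith) hτ0
            _ ≤ ε * (n * (T + 1)) := by
              refine mul_le_mul_of_nonneg_left ((hτle n).trans ?_) hε0.le
              exact mul_le_mul_of_nonneg_left (by linarith) n.cast_nonneg
            _ = n * (Real.log 2 / 2) := by
              rw [hε]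
              field_simp
    rw [← hq2, mul_pow] at h1
    have := pow_pos hqpos n
    nlinarith
  have htend : Tendsto (fun n : ℕ => q ^ n * ‖v‖) atTop atTop :=
    (tendsto_pow_atTop_atTop_of_one_lt hq1).atTop_mul_const (norm_pos_iff.2 hv)
  obtain ⟨n, hn⟩ := (htend.eventually_gt_atTop |C|).exists
  exact absurd (hbound n) (not_le.2 hn)

/-- For an irreducible system, the solutions from every point, rescaled by `e^{-σt}`, are uniformly
bounded. -/
theorem exists_bound_of_irreducible [FiniteDimensional ℝ E] [Nontrivial E] (hne : 𝒞.Nonempty)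
    (hconv : Convex ℝ 𝒞) (hclosed : IsClosed 𝒞) (hL : ∀ B ∈ 𝒞, ‖B‖ ≤ L)
    (hσ : IsGLB (growthRates 𝒞) σ)
    (hirr : ∀ W : Submodule ℝ E, (∀ B ∈ 𝒞, ∀ v ∈ W, B v ∈ W) → W = ⊥ ∨ W = ⊤) (v : E) :
    ∃ K : ℝ, ∀ A x, IsSolution 𝒞 A x → x 0 = v → ∀ t, 0 ≤ t →
      Real.exp (-(σ * t)) * ‖x t‖ ≤ K := by
  have : CompleteSpace E := FiniteDimensional.complete ℝ E
  -- Boundedness from `a` and `b` gives boundedness from `a + b`, since any law driving a solution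
  -- from `a + b` also drives one from `a`, and their difference starts at `b`.
  let W : Submodule ℝ E :=
    { carrier := {v | ∃ K : ℝ, ∀ A x, IsSolution 𝒞 A x → x 0 = v → ∀ t, 0 ≤ t →
        Real.exp (-(σ * t)) * ‖x t‖ ≤ K}
      zero_mem' := ⟨0, fun A x hx h0 t ht => by
        have := hx.norm_le hL ht
        rw [h0, norm_zero, zero_mul] at this
        rw [le_antisymm this (norm_nonneg _), mul_zero]⟩
      add_mem' := by
        rintro a b ⟨K, hK⟩ ⟨K', hK'⟩
        refine ⟨K + K', fun A x hx h0 t ht => ?_⟩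
        obtain ⟨y, hy, hy0⟩ := exists_isSolution hx.mem hx.meas hL a
        have h1 := hK A y hy hy0 t ht
        have h2 := hK' A _ (hx.sub hy hL) (by rw [h0, hy0, add_sub_cancel_left]) t ht
        have h3 := norm_add_le (y t) (x t - y t)
        rw [add_sub_cancel] at h3
        have := mul_le_mul_of_nonneg_left h3 (Real.exp_pos (-(σ * t))).le
        linarith
      smul_mem' := by
        rintro c a ⟨K, hK⟩
        refine ⟨|c| * K, fun A x hx h0 t ht => ?_⟩
        obtain ⟨y, hy, hy0⟩ := exists_isSolution hx.mem hx.meas hL a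
        have h1 := hK A y hy hy0 t ht
        have h2 : x t = c • y t := hx.eq_of_eqOn (hy.const_smul c) hL (fun _ _ => rfl)
          (by rw [h0, hy0]) ⟨ht, le_rfl⟩
        rw [h2, norm_smul, Real.norm_eq_abs, mul_left_comm]
        exact mul_le_mul_of_nonneg_left h1 (abs_nonneg c) }
  have hWinv : ∀ A x, IsSolution 𝒞 A x → x 0 ∈ W → ∀ t, 0 ≤ t → x t ∈ W := by
    rintro A x hx ⟨K, hK⟩ τ hτ
    refine ⟨Real.exp (σ * τ) * K, fun B y hy hy0 t ht => ?_⟩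
    obtain ⟨D, z, hz, hz1, hz2⟩ := hx.exists_concat hy hL hτ hy0
    have h1 := hK _ _ hz (hz1 0 hτ) (τ + t) (add_nonneg hτ ht)
    rw [hz2 t ht] at h1
    have h3 := mul_le_mul_of_nonneg_left h1 (Real.exp_pos (σ * τ)).le
    rw [← mul_assoc, ← Real.exp_add] at h3
    have h4 : σ * τ + -(σ * (τ + t)) = -(σ * t) := by ring
    rwa [h4] at h3
  rcases hirr W (apply_mem_of_forall_isSolution hL W hWinv) with hW | hW
  · exfalso
    obtain ⟨T, hT, h⟩ := exists_uniform_time (σ := σ) hne hL fun v hv K => by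
      by_contra! hcon
      have : v ∈ W := ⟨K, fun A x hx h0 t ht => hcon A x t hx h0 ht⟩
      rw [hW] at this
      exact hv this
    exact not_uniform_growth hne hconv hclosed hL hσ hT h
  · have : v ∈ W := by rw [hW]; trivial
    exact this

end SwitchingSystem

/-! ### Construction of the invariant norm as a limsup. -/

namespace SwitchingSystem

variable {E : Type*} [NormedAddCommGroup E] [NormedSpace ℝ E]

variable {𝒞 : Set (E →L[ℝ] E)} {A : ℝ → E →L[ℝ] E} {x : ℝ → E} {L σ T : ℝ}

/-- The solutions from every point are bounded after rescaling by `e^{-σt}`. -/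
def HasBoundedGrowth (𝒞 : Set (E →L[ℝ] E)) (σ : ℝ) : Prop :=
  ∀ v : E, ∃ K : ℝ, ∀ A x, IsSolution 𝒞 A x → x 0 = v → ∀ t, 0 ≤ t →
    Real.exp (-(σ * t)) * ‖x t‖ ≤ K

/-- The supremum of `e^{-σt} ‖x(t)‖` over all times `t ≥ T` and all solutions `x` from `v`. -/
noncomputable def tailSup (𝒞 : Set (E →L[ℝ] E)) (σ T : ℝ) (v : E) : ℝ :=
  sSup {r | ∃ A x t, IsSolution 𝒞 A x ∧ x 0 = v ∧ 0 ≤ t ∧ T ≤ t ∧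
    r = Real.exp (-(σ * t)) * ‖x t‖}

theorem HasBoundedGrowth.le_tailSup (hK : HasBoundedGrowth 𝒞 σ) (hx : IsSolution 𝒞 A x) {t : ℝ}
    (ht : 0 ≤ t) (hT : T ≤ t) : Real.exp (-(σ * t)) * ‖x t‖ ≤ tailSup 𝒞 σ T (x 0) := by
  obtain ⟨K, hK⟩ := hK (x 0)
  refine le_csSup ⟨K, ?_⟩ ⟨A, x, t, hx, rfl, ht, hT, rfl⟩
  rintro _ ⟨B, y, s, hy, h0, hs, -, rfl⟩
  exact hK B y hy h0 s hs

theorem exists_lt_tailSup [CompleteSpace E] (hne : 𝒞.Nonempty) (hL : ∀ B ∈ 𝒞, ‖B‖ ≤ L) {v : E}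
    {c : ℝ} (hc : c < tailSup 𝒞 σ T v) : ∃ A x t, IsSolution 𝒞 A x ∧ x 0 = v ∧ 0 ≤ t ∧ T ≤ t ∧
      c < Real.exp (-(σ * t)) * ‖x t‖ := by
  obtain ⟨A, x, hx, h0⟩ := exists_isSolution_of_nonempty hne hL v
  have hS : {r | ∃ A x t, IsSolution 𝒞 A x ∧ x 0 = v ∧ 0 ≤ t ∧ T ≤ t ∧
      r = Real.exp (-(σ * t)) * ‖x t‖}.Nonempty :=
    ⟨_, A, x, max T 0, hx, h0, le_max_right _ _, le_max_left _ _, rfl⟩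
  obtain ⟨_, ⟨B, y, t, hy, hy0, ht, hT, rfl⟩, h⟩ := exists_lt_of_lt_csSup hS hc
  exact ⟨B, y, t, hy, hy0, ht, hT, h⟩

theorem tailSup_le [CompleteSpace E] (hne : 𝒞.Nonempty) (hL : ∀ B ∈ 𝒞, ‖B‖ ≤ L) {v : E} {c : ℝ}
    (h : ∀ A x t, IsSolution 𝒞 A x → x 0 = v → 0 ≤ t → T ≤ t →
      Real.exp (-(σ * t)) * ‖x t‖ ≤ c) : tailSup 𝒞 σ T v ≤ c := by
  by_contra! hc
  obtain ⟨A, x, t, hx, h0, ht, hT, hlt⟩ := exists_lt_tailSup hne hL hc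
  exact absurd (h A x t hx h0 ht hT) (not_le.2 hlt)

theorem tailSup_nonneg (v : E) : 0 ≤ tailSup 𝒞 σ T v :=
  Real.sSup_nonneg (by rintro _ ⟨A, x, t, -, -, -, -, rfl⟩; positivity)

theorem HasBoundedGrowth.tailSup_anti [CompleteSpace E] (hK : HasBoundedGrowth 𝒞 σ)
    (hne : 𝒞.Nonempty) (hL : ∀ B ∈ 𝒞, ‖B‖ ≤ L) {S : ℝ} (hST : S ≤ T) (v : E) :
    tailSup 𝒞 σ T v ≤ tailSup 𝒞 σ S v :=
  tailSup_le hne hL fun A x t hx h0 ht hT => by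
    rw [← h0]
    exact hK.le_tailSup hx ht (hST.trans hT)

/-- `tailSup` as a seminorm. -/
noncomputable def tailSeminorm [CompleteSpace E] (hK : HasBoundedGrowth 𝒞 σ) (hne : 𝒞.Nonempty)
    (hL : ∀ B ∈ 𝒞, ‖B‖ ≤ L) (T : ℝ) : Seminorm ℝ E :=
  Seminorm.ofSMulLE (tailSup 𝒞 σ T)
    (by
      refine le_antisymm (tailSup_le hne hL fun A x t hx h0 ht hT => ?_) (tailSup_nonneg _)
      have := hx.norm_le hL ht
      rw [h0, norm_zero, zero_mul] at this
      rw [le_antisymm this (norm_nonneg _), mul_zero])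
    (fun a b => by
      refine tailSup_le hne hL fun A x t hx h0 ht hT => ?_
      obtain ⟨y, hy, rfl⟩ := exists_isSolution hx.mem hx.meas hL a
      have h1 := hK.le_tailSup hy ht hT
      have h2 := hK.le_tailSup (hx.sub hy hL) ht hT
      rw [h0, add_sub_cancel_left] at h2
      have h3 := norm_add_le (y t) (x t - y t)
      rw [add_sub_cancel] at h3
      have := mul_le_mul_of_nonneg_left h3 (Real.exp_pos (-(σ * t))).le
      linarith)
    (fun c a => by
      refine tailSup_le hne hL fun A x t hx h0 ht hT => ?_
      obtain ⟨y, hy, rfl⟩ := exists_isSolution hx.mem hx.meas hL a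
      have h2 : x t = c • y t := hx.eq_of_eqOn (hy.const_smul c) hL (fun _ _ => rfl)
        h0 ⟨ht, le_rfl⟩
      rw [h2, norm_smul, mul_left_comm]
      exact mul_le_mul_of_nonneg_left (hK.le_tailSup hy ht hT) (norm_nonneg c))

theorem tailSeminorm_apply [CompleteSpace E] (hK : HasBoundedGrowth 𝒞 σ) (hne : 𝒞.Nonempty)
    (hL : ∀ B ∈ 𝒞, ‖B‖ ≤ L) (T : ℝ) (v : E) :
    tailSeminorm hK hne hL T v = tailSup 𝒞 σ T v := rfl

theorem HasBoundedGrowth.tendsto_tailSup [CompleteSpace E] (hK : HasBoundedGrowth 𝒞 σ)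
    (hne : 𝒞.Nonempty) (hL : ∀ B ∈ 𝒞, ‖B‖ ≤ L) (v : E) :
    Tendsto (fun n : ℕ => tailSup 𝒞 σ n v) atTop (𝓝 (⨅ n : ℕ, tailSup 𝒞 σ n v)) :=
  tendsto_atTop_ciInf (fun _ _ hmn => hK.tailSup_anti hne hL (Nat.cast_le.2 hmn) v)
    ⟨0, by rintro _ ⟨n, rfl⟩; exact tailSup_nonneg v⟩

/-- The seminorm `limsup` of `e^{-σt} ‖x(t)‖` over all solutions `x` from a point. -/
noncomputable def limsupSeminorm [CompleteSpace E] (hK : HasBoundedGrowth 𝒞 σ)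
    (hne : 𝒞.Nonempty) (hL : ∀ B ∈ 𝒞, ‖B‖ ≤ L) : Seminorm ℝ E :=
  Seminorm.ofSMulLE (fun v => ⨅ n : ℕ, tailSup 𝒞 σ n v)
    (by
      have : ∀ n : ℕ, tailSup 𝒞 σ n 0 = 0 := fun n => map_zero (tailSeminorm hK hne hL n)
      simp [this])
    (fun a b => le_of_tendsto_of_tendsto' (hK.tendsto_tailSup hne hL _)
      ((hK.tendsto_tailSup hne hL a).add (hK.tendsto_tailSup hne hL b))
      fun n => map_add_le_add (tailSeminorm hK hne hL n) a b)
    (fun c a => le_of_tendsto_of_tendsto' (hK.tendsto_tailSup hne hL _)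
      ((hK.tendsto_tailSup hne hL a).const_mul _)
      fun n => (map_smul_eq_mul (tailSeminorm hK hne hL n) c a).le)

section limsupSeminorm

variable [CompleteSpace E] (hK : HasBoundedGrowth 𝒞 σ) (hne : 𝒞.Nonempty)
  (hL : ∀ B ∈ 𝒞, ‖B‖ ≤ L)

theorem tendsto_limsupSeminorm (v : E) :
    Tendsto (fun n : ℕ => tailSup 𝒞 σ n v) atTop (𝓝 (limsupSeminorm hK hne hL v)) :=
  hK.tendsto_tailSup hne hL v

theorem limsupSeminorm_le (T : ℝ) (v : E) : limsupSeminorm hK hne hL v ≤ tailSup 𝒞 σ T v := by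
  refine le_of_tendsto (tendsto_limsupSeminorm hK hne hL v) ?_
  filter_upwards [eventually_ge_atTop ⌈T⌉₊] with n hn
  exact hK.tailSup_anti hne hL (Nat.ceil_le.1 hn) v

theorem le_limsupSeminorm {v : E} {c : ℝ} (h : ∀ T, c ≤ tailSup 𝒞 σ T v) :
    c ≤ limsupSeminorm hK hne hL v :=
  ge_of_tendsto' (tendsto_limsupSeminorm hK hne hL v) fun n => h n

/-- Any solution from `x τ` continues `x` to a solution from `x 0` at a later time, so it competes
in the supremum at `x 0`, with weight `e^{-στ}`. -/
theorem limsupSeminorm_solution_le (hx : IsSolution 𝒞 A x) {τ : ℝ} (hτ : 0 ≤ τ) :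
    limsupSeminorm hK hne hL (x τ) ≤ Real.exp (σ * τ) * limsupSeminorm hK hne hL (x 0) := by
  have h : Real.exp (-(σ * τ)) * limsupSeminorm hK hne hL (x τ) ≤
      limsupSeminorm hK hne hL (x 0) := by
    refine le_limsupSeminorm hK hne hL fun T => ?_
    have h1 : limsupSeminorm hK hne hL (x τ) ≤ Real.exp (σ * τ) * tailSup 𝒞 σ T (x 0) := by
      refine (limsupSeminorm_le hK hne hL T _).trans (tailSup_le hne hL ?_)
      intro B y t hy hy0 ht hT
      obtain ⟨D, z, hz, hz1, hz2⟩ := hx.exists_concat hy hL hτ hy0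
      have h1 := hK.le_tailSup hz (t := τ + t) (T := T) (add_nonneg hτ ht) (by linarith)
      rw [hz2 t ht, hz1 0 hτ] at h1
      have h3 := mul_le_mul_of_nonneg_left h1 (Real.exp_pos (σ * τ)).le
      rw [← mul_assoc, ← Real.exp_add] at h3
      have h4 : σ * τ + -(σ * (τ + t)) = -(σ * t) := by ring
      rwa [h4] at h3
    have h2 := mul_le_mul_of_nonneg_left h1 (Real.exp_pos (-(σ * τ))).le
    rwa [← mul_assoc, ← Real.exp_add, neg_add_cancel, Real.exp_zero, one_mul] at h2
  have h2 := mul_le_mul_of_nonneg_left h (Real.exp_pos (σ * τ)).le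
  rwa [← mul_assoc, ← Real.exp_add, add_neg_cancel, Real.exp_zero, one_mul] at h2

/-- Solutions from `v` that nearly realise the limsup at times `t n ≥ n` have a limit `y`. For fixed
`τ` and `T`, what follows time `τ` on the `n`-th one bounds `tailSup` at `x n τ` from below.
Continuity of this seminorm carries the bound to `y τ`, for every `T`. -/
theorem exists_extremal_limsupSeminorm [FiniteDimensional ℝ E] (hconv : Convex ℝ 𝒞)
    (hclosed : IsClosed 𝒞) (v : E) : ∃ A x, IsSolution 𝒞 A x ∧ x 0 = v ∧ ∀ t, 0 ≤ t →
      limsupSeminorm hK hne hL (x t) = Real.exp (σ * t) * limsupSeminorm hK hne hL v := by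
  set f := limsupSeminorm hK hne hL with hf
  have hex : ∀ n : ℕ, ∃ A x t, IsSolution 𝒞 A x ∧ x 0 = v ∧ 0 ≤ t ∧ (n : ℝ) ≤ t ∧
      f v - 1 / ((n : ℝ) + 1) < Real.exp (-(σ * t)) * ‖x t‖ := fun n =>
    exists_lt_tailSup hne hL (lt_of_lt_of_le (sub_lt_self _ Nat.one_div_pos_of_nat)
      (limsupSeminorm_le hK hne hL n v))
  choose A x t hx hx0 ht hnt hlt using hex
  obtain ⟨B, y, hy, hlim⟩ := exists_isSolution_tendsto hconv hclosed hL (hyperfilter ℕ)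
    hx (R := ‖v‖) fun n => by rw [hx0]
  have hy0 : y 0 = v := tendsto_nhds_unique (hlim 0 le_rfl) (by simp [hx0])
  refine ⟨B, y, hy, hy0, fun τ hτ => le_antisymm ?_ ?_⟩
  · rw [← hy0]
    exact limsupSeminorm_solution_le hK hne hL hy hτ
  · refine le_limsupSeminorm hK hne hL fun T => ?_
    have h1 : Tendsto (fun n => tailSup 𝒞 σ T (x n τ)) (hyperfilter ℕ)
        (𝓝 (tailSup 𝒞 σ T (y τ))) :=
      ((seminorm_continuous (tailSeminorm hK hne hL T)).tendsto (y τ)).comp (hlim τ hτ)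
    have h2 : Tendsto (fun n : ℕ => Real.exp (σ * τ) * (f v - 1 / ((n : ℝ) + 1))) (hyperfilter ℕ)
        (𝓝 (Real.exp (σ * τ) * f v)) := by
      have := ((tendsto_const_nhds (x := f v)).sub
        tendsto_one_div_add_atTop_nhds_zero_nat).const_mul (Real.exp (σ * τ))
      rw [sub_zero] at this
      exact this.mono_left Nat.hyperfilter_le_atTop
    refine le_of_tendsto_of_tendsto h2 h1 ?_
    refine Nat.hyperfilter_le_atTop ?_
    filter_upwards [eventually_ge_atTop ⌈max τ (T + τ)⌉₊] with n hn
    have hn' := Nat.ceil_le.1 hn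
    have hn1 : τ ≤ t n := (le_max_left _ _).trans (hn'.trans (hnt n))
    have hn2 : T + τ ≤ t n := (le_max_right _ _).trans (hn'.trans (hnt n))
    have h3 := hK.le_tailSup ((hx n).shift hL hτ) (t := t n - τ) (T := T) (by linarith)
      (by linarith)
    simp only [sub_add_cancel, zero_add] at h3
    refine le_trans ?_ h3
    refine (mul_le_mul_of_nonneg_left (hlt n).le (Real.exp_pos (σ * τ)).le).trans (le_of_eq ?_)
    rw [← mul_assoc, ← Real.exp_add]
    congr 2
    ring

/-- If the limsup vanished everywhere, compactness of the sphere and monotonicity in `T` would give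
one time after which every rescaled solution is at most half its initial size. Iteration then yields
a growth rate below `σ`. -/
theorem limsupSeminorm_ne_zero [FiniteDimensional ℝ E] (hσ : IsGLB (growthRates 𝒞) σ) :
    ∃ v, limsupSeminorm hK hne hL v ≠ 0 := by
  by_contra! hzero
  have : ProperSpace E := FiniteDimensional.proper ℝ E
  have hunif : ∃ T, 0 ≤ T ∧ ∀ v ∈ Metric.sphere (0 : E) 1, tailSup 𝒞 σ T v ≤ 1 / 2 := by
    refine (isCompact_sphere (0 : E) 1).induction_on
      (p := fun S => ∃ T, 0 ≤ T ∧ ∀ v ∈ S, tailSup 𝒞 σ T v ≤ 1 / 2) ⟨0, le_rfl, by simp⟩ ?_ ?_ ?_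
    · rintro S S' hSS ⟨T, hT, h⟩
      exact ⟨T, hT, fun v hv => h v (hSS hv)⟩
    · rintro S S' ⟨T, hT, h⟩ ⟨T', hT', h'⟩
      refine ⟨max T T', hT.trans (le_max_left _ _), fun v hv => ?_⟩
      rcases hv with hv | hv
      · exact (hK.tailSup_anti hne hL (le_max_left _ _) v).trans (h v hv)
      · exact (hK.tailSup_anti hne hL (le_max_right _ _) v).trans (h' v hv)
    · intro v _
      have h1 := tendsto_limsupSeminorm hK hne hL v
      rw [hzero v] at h1
      obtain ⟨n, hn⟩ := (h1.eventually (gt_mem_nhds (one_half_pos (α := ℝ)))).exists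
      have h2 := (seminorm_continuous (tailSeminorm hK hne hL n)).continuousAt.eventually
        (gt_mem_nhds hn)
      exact ⟨_, mem_nhdsWithin_of_mem_nhds h2, n, n.cast_nonneg, fun u hu => le_of_lt hu⟩
  obtain ⟨T, hT, hT2⟩ := hunif
  have hhalf : ∀ v, tailSup 𝒞 σ T v ≤ 1 / 2 * ‖v‖ := by
    intro v
    rcases eq_or_ne v 0 with rfl | hv
    · rw [norm_zero, mul_zero]
      exact (map_zero (tailSeminorm hK hne hL T)).le
    · have hv' : 0 < ‖v‖ := norm_pos_iff.2 hv
      have h1 := hT2 (‖v‖⁻¹ • v) (by simp [norm_smul, hv'.ne'])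
      have h2 := map_smul_eq_mul (tailSeminorm hK hne hL T) ‖v‖⁻¹ v
      rw [tailSeminorm_apply, tailSeminorm_apply, norm_inv, norm_norm] at h2
      rwa [h2, ← div_eq_inv_mul, div_le_iff₀ hv'] at h1
  have hstep : ∀ A x, IsSolution 𝒞 A x → ∀ t, T ≤ t →
      ‖x t‖ ≤ Real.exp (σ * t) * (1 / 2 * ‖x 0‖) := fun A x hx t htT => by
    have h1 := (hK.le_tailSup hx (hT.trans htT) htT).trans (hhalf _)
    have h2 := mul_le_mul_of_nonneg_left h1 (Real.exp_pos (σ * t)).le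
    rwa [← mul_assoc, ← Real.exp_add, add_neg_cancel, Real.exp_zero, one_mul] at h2
  -- A strictly positive block length, since `T` may be `0`.
  set S : ℝ := T + 1 with hS
  have hS0 : 0 < S := by linarith
  have hpow : ∀ n : ℕ, ∀ A x, IsSolution 𝒞 A x →
      ‖x (n * S)‖ ≤ Real.exp (σ * (n * S)) * ((1 / 2) ^ n * ‖x 0‖) := by
    intro n
    induction n with
    | zero => intro A x _; simp
    | succ n ih =>
      intro A x hx
      have hnS : 0 ≤ (n : ℝ) * S := by positivity
      have h1 := hstep _ _ (hx.shift hL hnS) S (by linarith)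
      have h2 := ih A x hx
      simp only [zero_add] at h1
      have h3 : ((n + 1 : ℕ) : ℝ) * S = S + n * S := by push_cast; ring
      rw [h3, mul_add σ S, Real.exp_add, pow_succ]
      have h4 := mul_le_mul_of_nonneg_left h2
        (mul_nonneg (Real.exp_pos (σ * S)).le (one_half_pos (α := ℝ)).le)
      refine h1.trans ?_
      linarith
  set ε : ℝ := Real.log 2 / S with hε
  have hε0 : 0 < ε := div_pos (Real.log_pos one_lt_two) hS0
  have hmem : σ - ε ∈ growthRates 𝒞 := by
    intro A x hx
    obtain ⟨K, hKx⟩ : ∃ K : ℝ, ∀ r ∈ Icc (0 : ℝ) S, ∀ B y, IsSolution 𝒞 B y →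
        ‖y r‖ ≤ K * ‖y 0‖ := by
      refine ⟨Real.exp (L * S), fun r hr B y hy => ?_⟩
      rw [mul_comm]
      have hL0 : 0 ≤ L := (norm_nonneg _).trans (hL _ (hy.mem 0))
      refine (hy.norm_le hL hr.1).trans (mul_le_mul_of_nonneg_left ?_ (norm_nonneg _))
      exact Real.exp_le_exp.2 (mul_le_mul_of_nonneg_left hr.2 hL0)
    -- The first two factors absorb the incomplete last block, of length at most `S`.
    refine ⟨|K| * Real.exp (|σ - ε| * S) * ‖x 0‖, fun t ht => ?_⟩
    set n := ⌊t / S⌋₊ with hn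
    have hn1 : n * S ≤ t := by
      rw [← le_div_iff₀ hS0]
      exact Nat.floor_le (by positivity)
    have hn2 : t ≤ (n + 1) * S := by
      rw [← div_le_iff₀ hS0]
      exact (Nat.lt_floor_add_one _).le
    have hnS : 0 ≤ (n : ℝ) * S := by positivity
    have h1 := hKx (t - n * S) ⟨by linarith, by linarith⟩ _ _ (hx.shift hL hnS)
    simp only [sub_add_cancel, zero_add] at h1
    have h2 : (1 / 2 : ℝ) ^ n = Real.exp (-(ε * (n * S))) := by
      have : ε * (n * S) = n * Real.log 2 := by rw [hε]; field_simp
      rw [this, ← mul_neg, Real.exp_nat_mul, Real.exp_neg, Real.exp_log two_pos, one_div]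
    have h3 := hpow n A x hx
    rw [h2, ← mul_assoc, ← Real.exp_add] at h3
    have h4 : σ * (n * S) + -(ε * (n * S)) = (σ - ε) * (n * S) := by ring
    rw [h4] at h3
    have h5 : Real.exp ((σ - ε) * (n * S)) ≤
        Real.exp (|σ - ε| * S) * Real.exp ((σ - ε) * t) := by
      rw [← Real.exp_add]
      refine Real.exp_le_exp.2 ?_
      have h6 : -(σ - ε) * (t - n * S) ≤ |σ - ε| * S :=
        mul_le_mul (neg_le_abs _) (by linarith) (by linarith) (abs_nonneg _)
      linarith
    calc ‖x t‖ ≤ |K| * ‖x (n * S)‖ :=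
          h1.trans (mul_le_mul_of_nonneg_right (le_abs_self K) (norm_nonneg _))
      _ ≤ |K| * ((Real.exp (|σ - ε| * S) * Real.exp ((σ - ε) * t)) * ‖x 0‖) :=
          mul_le_mul_of_nonneg_left
            (h3.trans (mul_le_mul_of_nonneg_right h5 (norm_nonneg _))) (abs_nonneg K)
      _ = _ := by ring
  have := hσ.1 hmem
  linarith

/-- The kernel is a subspace invariant under solutions, hence under `𝒞`, and it is not everything by
`limsupSeminorm_ne_zero`. -/
theorem limsupSeminorm_definite [FiniteDimensional ℝ E] (hσ : IsGLB (growthRates 𝒞) σ)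
    (hirr : ∀ W : Submodule ℝ E, (∀ B ∈ 𝒞, ∀ v ∈ W, B v ∈ W) → W = ⊥ ∨ W = ⊤) {v : E}
    (hv : limsupSeminorm hK hne hL v = 0) : v = 0 := by
  set f := limsupSeminorm hK hne hL with hf
  let W : Submodule ℝ E :=
    { carrier := {v | f v = 0}
      zero_mem' := map_zero f
      add_mem' := fun {a b} ha hb => by
        have h := map_add_le_add f a b
        rw [mem_ofPred_eq] at ha hb
        rw [ha, hb, add_zero] at h
        exact le_antisymm h (apply_nonneg f _)
      smul_mem' := fun c a ha => by
        rw [mem_ofPred_eq] at ha ⊢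
        rw [map_smul_eq_mul, ha, mul_zero] }
  have hW := hirr W (apply_mem_of_forall_isSolution hL W fun A x hx h0 t ht => by
    have h1 := limsupSeminorm_solution_le hK hne hL hx ht
    have h2 : f (x 0) = 0 := h0
    rw [← hf, h2, mul_zero] at h1
    exact le_antisymm h1 (apply_nonneg f _))
  have hvW : v ∈ W := hv
  rcases hW with hW | hW
  · rwa [hW, Submodule.mem_bot] at hvW
  · obtain ⟨u, hu⟩ := limsupSeminorm_ne_zero hK hne hL hσ
    have : u ∈ W := by rw [hW]; trivial
    exact absurd this hu

end limsupSeminorm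

/-- Existence of a Barabanov norm. -/
theorem exists_invariant_seminorm [FiniteDimensional ℝ E] [Nontrivial E] (hne : 𝒞.Nonempty)
    (hconv : Convex ℝ 𝒞) (hclosed : IsClosed 𝒞) (hL : ∀ B ∈ 𝒞, ‖B‖ ≤ L)
    (hσ : IsGLB (growthRates 𝒞) σ)
    (hirr : ∀ W : Submodule ℝ E, (∀ B ∈ 𝒞, ∀ v ∈ W, B v ∈ W) → W = ⊥ ∨ W = ⊤) :
    ∃ f : Seminorm ℝ E, (∀ v, f v = 0 → v = 0) ∧
      (∀ A x, IsSolution 𝒞 A x → ∀ t, 0 ≤ t → f (x t) ≤ Real.exp (σ * t) * f (x 0)) ∧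
      ∀ v, ∃ A x, IsSolution 𝒞 A x ∧ x 0 = v ∧
        ∀ t, 0 ≤ t → f (x t) = Real.exp (σ * t) * f v := by
  have : CompleteSpace E := FiniteDimensional.complete ℝ E
  have hK : HasBoundedGrowth 𝒞 σ :=
    exists_bound_of_irreducible hne hconv hclosed hL hσ hirr
  exact ⟨limsupSeminorm hK hne hL, fun v => limsupSeminorm_definite hK hne hL hσ hirr,
    fun A x hx t ht => limsupSeminorm_solution_le hK hne hL hx ht,
    exists_extremal_limsupSeminorm hK hne hL hconv hclosed⟩

end SwitchingSystem

/-! ### Periodic laws from returns, and the planar dichotomy. -/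

namespace SwitchingSystem

section Periodic

variable {E : Type*} [NormedAddCommGroup E] [NormedSpace ℝ E]

variable {𝒞 : Set (E →L[ℝ] E)} {A : ℝ → E →L[ℝ] E} {x : ℝ → E} {L σ : ℝ}

/-- A solution which returns, up to sign and a factor `e^{σ(t-s)}`, to one of its points yields a
periodic law whose solution is periodic after rescaling. -/
theorem IsSolution.exists_periodic [CompleteSpace E] (hx : IsSolution 𝒞 A x)
    (hL : ∀ B ∈ 𝒞, ‖B‖ ≤ L) {s t c : ℝ} (hs : 0 ≤ s) (hst : s < t) (hc : c * c = 1)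
    (h : x t = (c * Real.exp (σ * (t - s))) • x s) :
    ∃ B y T, IsSolution 𝒞 B y ∧ y 0 = x s ∧ 0 < T ∧ (∀ r, B (r + T) = B r) ∧
      ∀ r, 0 ≤ r → y (r + T) = Real.exp (σ * T) • y r := by
  set τ := t - s with hτ
  have hτ0 : 0 < τ := sub_pos.2 hst
  have hx' := hx.shift hL hs
  -- The law on `[s, t)`, repeated with period `τ`.
  let B : ℝ → E →L[ℝ] E := fun r => A (τ * Int.fract (r / τ) + s)
  have hBm : StronglyMeasurable B := hx.meas.comp_measurable
    (((measurable_fract.comp (measurable_id.div_const τ)).const_mul τ).add_const s)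
  have hBper : ∀ r, B (r + τ) = B r := fun r => by
    simp only [B]
    rw [add_div, div_self hτ0.ne', Int.fract_add_one]
  obtain ⟨y, hy, hy0⟩ := exists_isSolution (A := B) (fun r => hx.mem _) hBm hL (x s)
  have hyτ : y τ = (c * Real.exp (σ * τ)) • y 0 := by
    have h1 : y τ = x (τ + s) := hy.eq_of_eqOn hx' hL (T := τ) (fun r hr => by
        have h2 : Int.fract (r / τ) = r / τ :=
          Int.fract_eq_self.2 ⟨div_nonneg hr.1 hτ0.le, (div_lt_one hτ0).2 hr.2⟩
        simp only [B, h2]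
        rw [mul_div_cancel₀ _ hτ0.ne']) (by simpa using hy0) ⟨hτ0.le, le_rfl⟩
    rw [h1, hy0, ← h, hτ, sub_add_cancel]
  have hshift : ∀ r, 0 ≤ r → y (r + τ) = (c * Real.exp (σ * τ)) • y r := fun r hr =>
    (hy.shift hL hτ0.le).eq_of_eqOn (hy.const_smul (c * Real.exp (σ * τ))) hL
      (fun r _ => hBper r) (by simpa using hyτ) (T := r) ⟨hr, le_rfl⟩
  -- Two turns are taken so that the sign `c` squares to `1`.
  refine ⟨B, y, τ + τ, hy, hy0, add_pos hτ0 hτ0, fun r => ?_, fun r hr => ?_⟩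
  · rw [← add_assoc, hBper, hBper]
  · rw [← add_assoc, hshift _ (add_nonneg hr hτ0.le), hshift r hr, smul_smul]
    congr 1
    rw [mul_mul_mul_comm, hc, one_mul, ← Real.exp_add]
    ring_nf

end Periodic

section Planar

variable {E : Type*} [NormedAddCommGroup E] [NormedSpace ℝ E]

/-- An injective curve on the unit sphere of a norm which stays on one side of a line converges. -/
theorem exists_tendsto_of_half_plane [FiniteDimensional ℝ E] (f : Seminorm ℝ E)
    (hf : ∀ v, f v = 0 → v = 0) {v w : E}
    (hvw : ∀ a b : ℝ, a • v + b • w = 0 → a = 0 ∧ b = 0) {p q : ℝ → ℝ} (hp : Continuous p)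
    (hq : Continuous q) (hq0 : ∀ t, 0 < t → 0 < q t) {z : ℝ → E} {c : ℝ}
    (hfz : ∀ t, 0 < t → f (z t) = c) (hz : ∀ t, 0 < t → z t = p t • v + q t • w)
    (hinj : ∀ s t, 0 < s → s < t → z s ≠ z t) : ∃ l, Tendsto z atTop (𝓝 l) := by
  -- `φ` is an angle measured from `w`, in `(-π/2, π/2)` as `q > 0`. Below, `G` sends an angle to
  -- the point of that direction on the level set `f = c`, so that `z = G ∘ φ`.
  let φ : ℝ → ℝ := fun t => Real.arctan (p t / q t)
  let u : ℝ → E := fun a => Real.sin a • v + Real.cos a • w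
  have hu : Continuous u := by fun_prop
  have hfu : ∀ a, f (u a) ≠ 0 := fun a h => by
    obtain ⟨h1, h2⟩ := hvw _ _ (hf _ h)
    have := Real.sin_sq_add_cos_sq a
    rw [h1, h2] at this
    norm_num at this
  let G : ℝ → E := fun a => (c / f (u a)) • u a
  have hG : Continuous G :=
    (continuous_const.div ((seminorm_continuous f).comp hu) hfu).smul hu
  have hzG : ∀ t, 0 < t → z t = G (φ t) := by
    intro t ht
    have hqt := hq0 t ht
    have hs : 0 < Real.sqrt (1 + (p t / q t) ^ 2) := Real.sqrt_pos.2 (by positivity)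
    have h1 : z t = (q t * Real.sqrt (1 + (p t / q t) ^ 2)) • u (φ t) := by
      rw [hz t ht]
      simp only [u, φ, Real.sin_arctan, Real.cos_arctan, smul_add, smul_smul]
      congr 2 <;> field_simp
    have h2 := hfz t ht
    rw [h1, map_smul_eq_mul, Real.norm_of_nonneg (by positivity)] at h2
    rw [h1]
    simp only [G]
    rw [← h2, mul_div_cancel_right₀ _ (hfu _)]
  -- The exponential turns `(0, ∞)` into the whole line, where a continuous injective function is
  -- strictly monotone; being bounded, it converges.
  let ψ : ℝ → ℝ := fun r => φ (Real.exp r)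
  have hψc : Continuous ψ := Real.continuous_arctan.comp
    ((hp.comp Real.continuous_exp).div (hq.comp Real.continuous_exp)
      fun r => (hq0 _ (Real.exp_pos r)).ne')
  have hψi : Function.Injective ψ := by
    have key : ∀ r r', r < r' → ψ r ≠ ψ r' := fun r r' hrr h =>
      hinj _ _ (Real.exp_pos r) (Real.exp_lt_exp.2 hrr) (by
        rw [hzG _ (Real.exp_pos r), hzG _ (Real.exp_pos r')]
        exact congrArg G h)
    intro r r' h
    rcases lt_trichotomy r r' with h1 | h1 | h1
    exacts [absurd h (key _ _ h1), h1, absurd h.symm (key _ _ h1)]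
  have hψlim : ∃ a, Tendsto ψ atTop (𝓝 a) := by
    rcases hψc.strictMono_of_inj hψi with h | h
    · exact ⟨_, tendsto_atTop_ciSup h.monotone
        ⟨Real.pi / 2, by rintro _ ⟨r, rfl⟩; exact (Real.arctan_lt_pi_div_two _).le⟩⟩
    · exact ⟨_, tendsto_atTop_ciInf h.antitone
        ⟨-(Real.pi / 2), by rintro _ ⟨r, rfl⟩; exact (Real.neg_pi_div_two_lt_arctan _).le⟩⟩
  obtain ⟨a, ha⟩ := hψlim
  refine ⟨G a, ((hG.tendsto a).comp (ha.comp Real.tendsto_log_atTop)).congr' ?_⟩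
  filter_upwards [eventually_gt_atTop 0] with t ht
  simp only [Function.comp_apply, ψ, Real.exp_log ht]
  exact (hzG t ht).symm

/-- A curve on the unit sphere of a norm of the plane either meets one of its points again, up to
sign, or converges. -/
theorem returns_or_tendsto (f : Seminorm ℝ (Fin 2 → ℝ)) (hf : ∀ v, f v = 0 → v = 0)
    {z : ℝ → Fin 2 → ℝ} (hz : Continuous z) {c : ℝ} (hc : 0 < c)
    (hfz : ∀ t, 0 ≤ t → f (z t) = c) :
    (∃ s t e : ℝ, 0 ≤ s ∧ s < t ∧ e * e = 1 ∧ z t = e • z s) ∨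
      ∃ l, Tendsto z atTop (𝓝 l) := by
  by_contra! hcon
  obtain ⟨hret, hlim⟩ := hcon
  set a := z 0 0 with ha
  set b := z 0 1 with hb
  -- `v` is the starting point, `w` its rotation by a right angle; `p` and `q` are the coordinates
  -- of `z` in this basis.
  set v : Fin 2 → ℝ := ![a, b] with hv
  set w : Fin 2 → ℝ := ![-b, a] with hw
  have hzv : z 0 = v := by
    ext i
    fin_cases i <;> simp [hv, ha, hb]
  have hd : 0 < a ^ 2 + b ^ 2 := by
    by_contra hle
    have h1 : a = 0 := by nlinarith [sq_nonneg a, sq_nonneg b]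
    have h2 : b = 0 := by nlinarith [sq_nonneg a, sq_nonneg b]
    have h3 : z 0 = 0 := by
      rw [hzv, hv, h1, h2]
      ext i
      fin_cases i <;> rfl
    have := hfz 0 le_rfl
    rw [h3, map_zero] at this
    exact hc.ne this
  let p : ℝ → ℝ := fun t => (a * z t 0 + b * z t 1) / (a ^ 2 + b ^ 2)
  let q : ℝ → ℝ := fun t => (a * z t 1 - b * z t 0) / (a ^ 2 + b ^ 2)
  have hz0 : Continuous fun t => z t 0 := (continuous_apply 0).comp hz
  have hz1 : Continuous fun t => z t 1 := (continuous_apply 1).comp hz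
  have hp : Continuous p := by fun_prop
  have hq : Continuous q := by fun_prop
  have hzpq : ∀ t, z t = p t • v + q t • w := by
    intro t
    ext i
    fin_cases i <;> simp [p, q, hv, hw] <;> field_simp <;> ring
  have hvw : ∀ α β : ℝ, α • v + β • w = 0 → α = 0 ∧ β = 0 := by
    intro α β h
    have h0 := congrFun h 0
    have h1 := congrFun h 1
    simp [hv, hw] at h0 h1
    constructor
    · have : α * (a ^ 2 + b ^ 2) = 0 := by linear_combination a * h0 + b * h1
      exact (mul_eq_zero.1 this).resolve_right hd.ne'
    · have : β * (a ^ 2 + b ^ 2) = 0 := by linear_combination a * h1 - b * h0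
      exact (mul_eq_zero.1 this).resolve_right hd.ne'
  -- On the line through `z 0`, the level set of `f` contains only `± z 0`, so a zero of `q` would
  -- be a return up to sign.
  have hq0 : ∀ t, 0 < t → q t ≠ 0 := by
    intro t ht h
    have h1 := hzpq t
    rw [h, zero_smul, add_zero, ← hzv] at h1
    have h2 := hfz t ht.le
    rw [h1, map_smul_eq_mul, hfz 0 le_rfl, mul_eq_right₀ hc.ne', Real.norm_eq_abs] at h2
    exact hret 0 t (p t) le_rfl ht (by rw [← abs_mul_abs_self, h2, one_mul]) h1
  have hinj : ∀ s t, 0 < s → s < t → z s ≠ z t := fun s t hs hst h =>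
    hret s t 1 hs.le hst (one_mul 1) (by rw [one_smul, h])
  have hsign : (∀ t, 0 < t → 0 < q t) ∨ ∀ t, 0 < t → 0 < -q t := by
    by_contra! hcon
    obtain ⟨⟨t, ht, hqt⟩, s, hs, hqs⟩ := hcon
    have : (0 : ℝ) ∈ q '' Ioi 0 :=
      (isPreconnected_Ioi.image q hq.continuousOn).ordConnected.out ⟨t, ht, rfl⟩ ⟨s, hs, rfl⟩
        ⟨hqt, by linarith⟩
    obtain ⟨r, hr, hr0⟩ := this
    exact hq0 r hr hr0
  have hfz' : ∀ t, 0 < t → f (z t) = c := fun t ht => hfz t ht.le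
  rcases hsign with h | h
  · obtain ⟨l, hl⟩ := exists_tendsto_of_half_plane f hf hvw hp hq h hfz' (fun t _ => hzpq t) hinj
    exact hlim l hl
  · obtain ⟨l, hl⟩ := exists_tendsto_of_half_plane f hf (v := v) (w := -w)
      (fun α β hαβ => by
        have := hvw α (-β) (by simpa using hαβ)
        simpa using this) hp hq.neg h hfz' (fun t _ => by simpa using hzpq t) hinj
    exact hlim l hl

end Planar

/-- The dichotomy is applied to `z t = e^{-σt} x t`, for `x` extremal. If `z` tends to `l`, then `l
≠ 0` because `f` is constant along `z`, and the shifted solutions `e^{-σn} x (t + n)` tend to the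
solution `e^{σt} l`, which returns to its direction after any time. -/
theorem exists_periodic_of_planar {𝒞 : Set ((Fin 2 → ℝ) →L[ℝ] (Fin 2 → ℝ))} {L σ : ℝ}
    (hconv : Convex ℝ 𝒞) (hclosed : IsClosed 𝒞) (hL : ∀ B ∈ 𝒞, ‖B‖ ≤ L)
    (f : Seminorm ℝ (Fin 2 → ℝ)) (hf : ∀ v, f v = 0 → v = 0)
    (hext : ∀ v, ∃ A x, IsSolution 𝒞 A x ∧ x 0 = v ∧
      ∀ t, 0 ≤ t → f (x t) = Real.exp (σ * t) * f v) :
    ∃ B y T, IsSolution 𝒞 B y ∧ y 0 ≠ 0 ∧ 0 < T ∧ (∀ r, B (r + T) = B r) ∧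
      ∀ r, 0 ≤ r → y (r + T) = Real.exp (σ * T) • y r := by
  obtain ⟨v, hv⟩ := exists_ne (0 : Fin 2 → ℝ)
  have hfv : 0 < f v := lt_of_le_of_ne (apply_nonneg f v) fun h => hv (hf v h.symm)
  obtain ⟨A, x, hx, hx0, hfx⟩ := hext v
  have hexp : ∀ t, Real.exp (σ * t) * Real.exp (-(σ * t)) = 1 := fun t => by
    rw [← Real.exp_add, add_neg_cancel, Real.exp_zero]
  set z : ℝ → Fin 2 → ℝ := fun t => Real.exp (-(σ * t)) • x t with hz
  have hzc : Continuous z :=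
    (by fun_prop : Continuous fun t : ℝ => Real.exp (-(σ * t))).smul hx.cont
  have hxz : ∀ t, x t = Real.exp (σ * t) • z t := fun t => by
    rw [hz, smul_smul, hexp, one_smul]
  have hfz : ∀ t, 0 ≤ t → f (z t) = f v := fun t ht => by
    rw [hz, map_smul_eq_mul, hfx t ht, Real.norm_of_nonneg (Real.exp_pos _).le, ← mul_assoc,
      mul_comm (Real.exp _), hexp, one_mul]
  rcases returns_or_tendsto f hf hzc hfv hfz with ⟨s, t, e, hs, hst, he, h⟩ | ⟨l, hl⟩
  · obtain ⟨B, y, T, hy, hy0, hT, hB, hyT⟩ := hx.exists_periodic (σ := σ) hL hs hst he (by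
      rw [hxz t, h, hz, smul_smul, smul_smul, mul_assoc, mul_left_comm, ← Real.exp_add]
      ring_nf)
    refine ⟨B, y, T, hy, fun h0 => ?_, hT, hB, hyT⟩
    have h1 := hfx s hs
    rw [← hy0, h0, map_zero] at h1
    exact (mul_pos (Real.exp_pos _) hfv).ne h1
  · have hl0 : l ≠ 0 := by
      rintro rfl
      have h1 : Tendsto (fun t => f (z t)) atTop (𝓝 (f 0)) :=
        ((seminorm_continuous f).tendsto 0).comp hl
      have h2 : Tendsto (fun t => f (z t)) atTop (𝓝 (f v)) := tendsto_const_nhds.congr' (by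
        filter_upwards [eventually_ge_atTop 0] with t ht using (hfz t ht).symm)
      rw [map_zero] at h1
      exact hfv.ne (tendsto_nhds_unique h1 h2)
    have hn : ∀ n : ℕ, IsSolution 𝒞 (fun t => A (t + n))
        (fun t => Real.exp (-(σ * n)) • x (t + n)) := fun n =>
      (hx.shift hL n.cast_nonneg).const_smul _
    obtain ⟨K, -, hK⟩ := exists_norm_le_mul_seminorm f hf
    obtain ⟨B, y, hy, hlim⟩ := exists_isSolution_tendsto hconv hclosed hL (hyperfilter ℕ) hn
      (R := K * f v) (fun n => by
        have h1 := hK (z n)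
        rw [hfz n n.cast_nonneg] at h1
        simpa [hz] using h1)
    have hyl : ∀ t, 0 ≤ t → y t = Real.exp (σ * t) • l := by
      intro t ht
      refine tendsto_nhds_unique (hlim t ht) ?_
      have h1 : Tendsto (fun n : ℕ => z (t + n)) atTop (𝓝 l) :=
        hl.comp (tendsto_atTop_add_const_left _ _ tendsto_natCast_atTop_atTop)
      refine ((h1.const_smul (Real.exp (σ * t))).congr fun n => ?_).mono_left
        Nat.hyperfilter_le_atTop
      rw [hz, smul_smul, ← Real.exp_add]
      ring_nf
    have hy0 : y 0 = l := by simpa using hyl 0 le_rfl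
    obtain ⟨B', y', T, hy', hy'0, hT, hB, hyT⟩ := hy.exists_periodic (σ := σ) hL le_rfl zero_lt_one
      (one_mul 1) (by rw [hyl 1 zero_le_one, hy0]; simp)
    exact ⟨B', y', T, hy', by rwa [hy'0, hy0], hT, hB, hyT⟩

end SwitchingSystem

/-! ### Transfer between matrices and operators, and conclusion. -/

namespace SwitchingSystem

/-- A matrix as a continuous operator. -/
noncomputable def toOperator (d : ℕ) :
    Matrix (Fin d) (Fin d) ℝ ≃ₗ[ℝ] ((Fin d → ℝ) →L[ℝ] (Fin d → ℝ)) :=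
  Matrix.toLin' ≪≫ₗ LinearMap.toContinuousLinearMap

theorem toOperator_apply {d : ℕ} (M : Matrix (Fin d) (Fin d) ℝ) (v : Fin d → ℝ) :
    toOperator d M v = M *ᵥ v := by
  simp [toOperator]

theorem continuous_toOperator (d : ℕ) : Continuous (toOperator d) :=
  (toOperator d).toLinearMap.continuous_of_finiteDimensional

theorem continuous_toOperator_symm (d : ℕ) : Continuous (toOperator d).symm :=
  (toOperator d).symm.toLinearMap.continuous_of_finiteDimensional

variable {d : ℕ} {𝒜 : Set (Matrix (Fin d) (Fin d) ℝ)} {A : ℝ → Matrix (Fin d) (Fin d) ℝ}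
  {x : ℝ → Fin d → ℝ}

theorem IsTrajectory.continuousOn (h : IsTrajectory 𝒜 A x) : ContinuousOn x (Ici 0) := by
  intro t ht
  have ht0 : (0 : ℝ) ≤ t := ht
  have hT : (0 : ℝ) ≤ t + 1 := by linarith
  have h1 : ContinuousOn x (Icc 0 (t + 1)) := by
    have h2 := intervalIntegral.continuousOn_primitive_interval
      ((intervalIntegrable_iff' ).1 (h.integrable (t + 1) hT))
    rw [uIcc_of_le hT] at h2
    exact (continuousOn_const.add h2).congr fun s hs => h.eq s hs.1
  refine (h1 t ⟨ht0, by linarith⟩).mono_of_mem_nhdsWithin ?_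
  rw [← Ici_inter_Iic]
  exact inter_mem_nhdsWithin _ (Iic_mem_nhds (lt_add_one t))

/-- `IsSolution` constrains the law and the continuity on the whole line, whereas a trajectory is
arbitrary at negative times; both are frozen there at their values at `0`. -/
theorem IsTrajectory.isSolution (h : IsTrajectory 𝒜 A x) :
    IsSolution (toOperator d '' 𝒜) (fun t => toOperator d (A (max t 0)))
      (fun t => x (max t 0)) where
  mem t := mem_image_of_mem _ (h.law.mem _ (le_max_right _ _))
  meas := by
    have hmax : Measurable fun t : ℝ => (⟨max t 0, le_max_right t 0⟩ : Ici (0 : ℝ)) :=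
      (measurable_id.max measurable_const).subtype_mk
    have h1 : StronglyMeasurable fun t : ℝ => (fun i j => A (max t 0) i j : Fin d → Fin d → ℝ) := by
      refine Measurable.stronglyMeasurable ?_
      refine measurable_pi_iff.2 fun i => measurable_pi_iff.2 fun j => ?_
      exact (h.law.measurable i j).comp hmax
    exact (continuous_toOperator d).comp_stronglyMeasurable h1
  cont := h.continuousOn.comp_continuous (continuous_id.max continuous_const)
    fun t => le_max_right t 0
  eq t ht := by
    rw [max_eq_left ht, max_self, h.eq t ht]
    congr 1
    refine intervalIntegral.integral_congr fun s hs => ?_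
    rw [uIcc_of_le ht] at hs
    simp only [max_eq_left hs.1, toOperator_apply]

theorem IsSolution.isTrajectory {B : ℝ → (Fin d → ℝ) →L[ℝ] (Fin d → ℝ)} {L : ℝ}
    (h : IsSolution (toOperator d '' 𝒜) B x) (hL : ∀ M ∈ toOperator d '' 𝒜, ‖M‖ ≤ L) :
    IsTrajectory 𝒜 (fun t => (toOperator d).symm (B t)) x := by
  have happ : ∀ t v, (toOperator d).symm (B t) *ᵥ v = B t v := fun t v => by
    rw [← toOperator_apply, LinearEquiv.apply_symm_apply]
  refine ⟨⟨fun t _ => ?_, fun i j => ?_⟩, fun t _ => ?_, fun t ht => ?_⟩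
  · obtain ⟨M, hM, hMB⟩ := h.mem t
    rw [← hMB, LinearEquiv.symm_apply_apply]
    exact hM
  · have h1 : Continuous fun M : (Fin d → ℝ) →L[ℝ] (Fin d → ℝ) => (toOperator d).symm M i j :=
      (continuous_apply_apply i j).comp (continuous_toOperator_symm d)
    exact (h1.comp_stronglyMeasurable h.meas).measurable.comp measurable_subtype_coe
  · simp only [happ]
    exact h.intervalIntegrable hL 0 t
  · simp only [happ]
    exact h.eq t ht

theorem lyapunovExponent_eq {L : ℝ} (hL : ∀ M ∈ toOperator d '' 𝒜, ‖M‖ ≤ L) :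
    lyapunovExponent 𝒜 = sInf (growthRates (toOperator d '' 𝒜)) := by
  refine congrArg sInf (Set.ext fun s => ⟨fun hs B y hy => hs _ y (hy.isTrajectory hL),
    fun hs A x hx => ?_⟩)
  obtain ⟨C, hC⟩ := hs _ _ hx.isSolution
  exact ⟨C, fun t ht => by simpa [max_eq_left ht] using hC t ht⟩

/-- A solution which is periodic after rescaling by `e^{-σt}` is extremal for every invariant
norm. -/
theorem IsBarabanovNorm.eq_of_periodic {f : Seminorm ℝ (Fin d → ℝ)} (hf : IsBarabanovNorm 𝒜 f)
    {B : ℝ → (Fin d → ℝ) →L[ℝ] (Fin d → ℝ)} {L T : ℝ}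
    (h : IsSolution (toOperator d '' 𝒜) B x) (hL : ∀ M ∈ toOperator d '' 𝒜, ‖M‖ ≤ L) (hT : 0 < T)
    (hper : ∀ t, 0 ≤ t → x (t + T) = Real.exp (lyapunovExponent 𝒜 * T) • x t) {t : ℝ}
    (ht : 0 ≤ t) : f (x t) = Real.exp (lyapunovExponent 𝒜 * t) * f (x 0) := by
  set σ := lyapunovExponent 𝒜 with hσ
  refine le_antisymm (hf.le _ x (h.isTrajectory hL) t ht) ?_
  have hn : ∀ n : ℕ, f (x (n * T)) = Real.exp (σ * (n * T)) * f (x 0) := by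
    intro n
    induction n with
    | zero => simp
    | succ n ih =>
      have h1 : ((n + 1 : ℕ) : ℝ) * T = n * T + T := by push_cast; ring
      rw [h1, hper _ (by positivity), map_smul_eq_mul, ih, Real.norm_of_nonneg (Real.exp_pos _).le,
        ← mul_assoc, ← Real.exp_add]
      ring_nf
  -- At the return time `n * T ≥ t` equality holds, and between `t` and `n * T` the norm grows at
  -- most at rate `σ`; hence nothing was lost before `t`.
  obtain ⟨n, hnt⟩ := exists_nat_ge (t / T)
  rw [div_le_iff₀ hT] at hnt
  have h1 := hf.le _ _ ((h.shift hL ht).isTrajectory hL) (n * T - t) (by linarith)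
  simp only [sub_add_cancel, zero_add] at h1
  rw [hn n, ← hσ] at h1
  have h2 := mul_le_mul_of_nonneg_left h1 (Real.exp_pos (-(σ * (n * T - t)))).le
  rw [← mul_assoc, ← mul_assoc (Real.exp _) (Real.exp _) (f (x t)), ← Real.exp_add,
    ← Real.exp_add, neg_add_cancel, Real.exp_zero, one_mul] at h2
  have h3 : -(σ * (n * T - t)) + σ * (n * T) = σ * t := by ring
  rwa [h3] at h2

/-- For the empty set every line would be invariant, and in the plane a line is neither `⊥` nor `⊤`.
-/
theorem Irreducible.nonempty {𝒜 : Set (Matrix (Fin 2) (Fin 2) ℝ)} (h : Irreducible 𝒜) :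
    𝒜.Nonempty := by
  by_contra hne
  rw [not_nonempty_iff_eq_empty] at hne
  subst hne
  rcases h (Submodule.span ℝ {Pi.single 0 1}) (by simp) with h1 | h1
  · rw [Submodule.span_singleton_eq_bot] at h1
    simpa using congrFun h1 0
  · have h2 : (Pi.single 1 1 : Fin 2 → ℝ) ∈ Submodule.span ℝ {(Pi.single 0 1 : Fin 2 → ℝ)} := by
      rw [h1]
      trivial
    obtain ⟨c, hc⟩ := Submodule.mem_span_singleton.1 h2
    simpa using congrFun hc 1

end SwitchingSystem

theorem corollaryc12 (𝒜 : Set (Matrix (Fin 2) (Fin 2) ℝ)) (hcomp : IsCompact 𝒜)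
    (hconv : Convex ℝ 𝒜) (hirr : SwitchingSystem.Irreducible 𝒜) :
    -- a Barabanov norm exists, so that "extremal" below is meaningful
    (∃ f, SwitchingSystem.IsBarabanovNorm 𝒜 f) ∧
    -- if `σ(𝒜) = 0`, there is a nonzero periodic extremal trajectory, with a periodic law
    (SwitchingSystem.lyapunovExponent 𝒜 = 0 →
      ∃ (A : ℝ → Matrix (Fin 2) (Fin 2) ℝ) (x : ℝ → Fin 2 → ℝ) (T : ℝ),
        SwitchingSystem.IsTrajectory 𝒜 A x ∧ x 0 ≠ 0 ∧
        SwitchingSystem.IsPeriodic A T ∧ SwitchingSystem.IsPeriodic x T ∧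
        ∀ f, SwitchingSystem.IsBarabanovNorm 𝒜 f → SwitchingSystem.IsExtremal 𝒜 f A x) ∧
    -- for any `σ(𝒜)`, the fastest growth is achieved by a periodic switching law
    (∃ (A : ℝ → Matrix (Fin 2) (Fin 2) ℝ) (x : ℝ → Fin 2 → ℝ) (T : ℝ),
        SwitchingSystem.IsTrajectory 𝒜 A x ∧ x 0 ≠ 0 ∧
        SwitchingSystem.IsPeriodic A T ∧
        SwitchingSystem.IsPeriodic
          (fun t => Real.exp (-(SwitchingSystem.lyapunovExponent 𝒜 * t)) • x t) T ∧
        (∀ f, SwitchingSystem.IsBarabanovNorm 𝒜 f → SwitchingSystem.IsExtremal 𝒜 f A x) ∧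
        ∀ B y, SwitchingSystem.IsTrajectory 𝒜 B y →
          ∃ C : ℝ, ∀ t, 0 ≤ t → ‖y t‖ ≤ C * ‖x t‖) := by
  open SwitchingSystem in
  have hcomp' : IsCompact (toOperator 2 '' 𝒜) := hcomp.image (continuous_toOperator 2)
  have hconv' : Convex ℝ (toOperator 2 '' 𝒜) := hconv.linear_image (toOperator 2).toLinearMap
  obtain ⟨L, hL⟩ := hcomp'.isBounded.exists_norm_le
  have hne := hirr.nonempty.image (toOperator 2)
  have hσ := isGLB_sInf_growthRates hne hL
  rw [← lyapunovExponent_eq hL] at hσ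
  set σ := lyapunovExponent 𝒜 with hσdef
  have hirr' : ∀ W : Submodule ℝ (Fin 2 → ℝ), (∀ B ∈ toOperator 2 '' 𝒜, ∀ v ∈ W, B v ∈ W) →
      W = ⊥ ∨ W = ⊤ := fun W hW => hirr W fun M hM v hv => by
    rw [← toOperator_apply]
    exact hW _ (mem_image_of_mem _ hM) v hv
  obtain ⟨f, hf0, hfle, hfext⟩ :=
    exists_invariant_seminorm hne hconv' hcomp'.isClosed hL hσ hirr'
  have hf : IsBarabanovNorm 𝒜 f := by
    refine ⟨hf0, fun A x hx t ht => ?_, fun v => ?_⟩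
    · simpa [max_eq_left ht] using hfle _ _ hx.isSolution t ht
    · obtain ⟨A, x, hx, hx0, h⟩ := hfext v
      refine ⟨fun t => (toOperator 2).symm (A t), x, hx0, ?_, fun t ht => by rw [hx0, h t ht]⟩
      rw [hconv.convexHull_eq]
      exact hx.isTrajectory hL
  obtain ⟨B, x, T, hx, hx0, hT, hB, hper⟩ :=
    exists_periodic_of_planar hconv' hcomp'.isClosed hL f hf0 hfext
  have hxtraj := hx.isTrajectory hL
  have hBper : IsPeriodic (fun t => (toOperator 2).symm (B t)) T :=
    ⟨hT, fun t _ => by simp only [hB]⟩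
  have hext : ∀ f, IsBarabanovNorm 𝒜 f →
      IsExtremal 𝒜 f (fun t => (toOperator 2).symm (B t)) x := fun g hg =>
    ⟨by rwa [hconv.convexHull_eq], fun t ht => hg.eq_of_periodic hx hL hT hper ht⟩
  refine ⟨⟨f, hf⟩, fun h0 => ⟨_, x, T, hxtraj, hx0, hBper, ⟨hT, fun t ht => ?_⟩, hext⟩,
    _, x, T, hxtraj, hx0, hBper, ⟨hT, fun t ht => ?_⟩, hext, fun A y hy => ?_⟩
  · rw [hper t ht, h0, zero_mul, Real.exp_zero, one_smul]
  · simp only [hper t ht, smul_smul, ← Real.exp_add]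
    ring_nf
  · obtain ⟨K, hK0, hK⟩ := exists_norm_le_mul_seminorm f hf0
    obtain ⟨K', hK'0, hK'⟩ := exists_seminorm_le_mul_norm f
    have hfx0 : 0 < f (x 0) :=
      lt_of_le_of_ne (apply_nonneg f _) fun h => hx0 (hf0 _ h.symm)
    -- `K` and `K'` compare `f` with the norm in both directions; the quotient compares `f (y t)`
    -- with `f (x t)`, as `x` grows exactly like `e^{σt}` in `f`.
    refine ⟨K * (f (y 0) / f (x 0) * K'), fun t ht => (hK _).trans ?_⟩
    rw [mul_assoc]
    refine mul_le_mul_of_nonneg_left ?_ hK0.le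
    calc f (y t) ≤ Real.exp (σ * t) * f (y 0) := hf.le A y hy t ht
      _ = f (y 0) / f (x 0) * f (x t) := by
        rw [(hext f hf).2 t ht, ← hσdef]
        field_simp
      _ ≤ f (y 0) / f (x 0) * (K' * ‖x t‖) :=
        mul_le_mul_of_nonneg_left (hK' _) (div_nonneg (apply_nonneg f _) hfx0.le)
      _ = _ := by ring
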